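/- Let $q=p^m>2$ with $p$ a prime and $m$ a positive integer, put $n=q^2+1$, and let $\lambda\in\mathbb{F}_{q^2}^*$ have multiplicative order $r$ with $r\mid (q+1)$ and $\nu_2(r)=\nu_2(q+1)$, where $\nu_2$ is the 2-adic valuation. There is a primitive element $\beta$ of $\mathbb{F}_{q^4}$ such that $\delta=\beta^{(q^2-1)/r}$ satisfies $\delta^n=\lambda$. For every such $\beta$, let $g_i(x)$ be the minimal polynomial of $\delta^i$ over $\mathbb{F}_{q^2}$. Then $h(x)=g_1(x)\,g_{q^2+q+1}(x)$ divides $x^n-\lambda$; let $\mathcal{C}=\mathcal{C}(1,q^2+q+1)\subseteq\mathbb{F}_{q^2}^n$ be the $\lambda$-constacyclic code with check polynomial $h$, i.e. the set of all $(c_0,\dots,c_{n-1})$ such that $\sum_i c_ix^i$ lies in the ideal of $\mathbb{F}_{q^2}[x]/\langle x^n-\lambda\rangle$ generated by $(x^n-\lambda)/h(x)$. Then: (1) $\mathcal{C}$ is a $[q^2+1,\,4,\,q^2-q]$ code over $\mathbb{F}_{q^2}$ with weight enumerator $$1+(q^5-q)z^{q^2-q}+\frac{(q^4-1)(q-1)q^3}{2}\left(z^{q^2-1}+z^{q^2+1}\right)+(q^7-q^5+q^4-q^3+q-1)z^{q^2}.$$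 (2) The supports (without repetition) of the codewords of minimum nonzero weight $q^2-q$ of $\mathcal{C}$ are the blocks of a $3$-$(q^2+1,\;q^2-q,\;(q^2-q-1)(q-2))$ design on the set of coordinate positions. (3) The dual code $\mathcal{C}^\perp$ (with respect to the standard bilinear form $\sum_i x_iy_i$) is a $[q^2+1,\,q^2-3,\,4]$ code over $\mathbb{F}_{q^2}$. (4) The supports (without repetition) of the codewords of minimum nonzero weight $4$ of $\mathcal{C}^\perp$ are the blocks of a $3$-$(q^2+1,\;4,\;q-2)$ design on the set of coordinate positions. -/

import Mathlib

open Polynomial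

noncomputable section

namespace ConstacyclicDesign

/-- The map `(c₀, …, c_{n-1}) ↦ ∑ cᵢ xⁱ` from `Fⁿ` to `F[x]/(xⁿ - lam)`. -/
def toQuotient {F : Type*} [Field F] (n : ℕ) (lam : F) :
    (Fin n → F) →ₗ[F] AdjoinRoot (X ^ n - C lam : F[X]) :=
  ∑ i : Fin n,
    (LinearMap.toSpanSingleton F (AdjoinRoot (X ^ n - C lam : F[X]))
      (AdjoinRoot.root (X ^ n - C lam : F[X]) ^ (i : ℕ))).comp (LinearMap.proj i)

/-- The code of length `n` corresponding to the ideal generated by `g` in `F[x]/(xⁿ - lam)`. -/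
def codeOfGenerator {F : Type*} [Field F] (n : ℕ) (lam : F) (g : F[X]) :
    Submodule F (Fin n → F) :=
  ((Ideal.span {AdjoinRoot.mk (X ^ n - C lam : F[X]) g}).restrictScalars F).comap
    (toQuotient n lam)

/-- The `lam`-constacyclic code of length `n` with check polynomial `h` (meant for
`h ∣ xⁿ - lam`): its generator polynomial is `(xⁿ - lam) / h`. -/
def codeOfCheck {F : Type*} [Field F] (n : ℕ) (lam : F) (h : F[X]) :
    Submodule F (Fin n → F) :=
  codeOfGenerator n lam ((X ^ n - C lam) / h)

/-- `C` is closed under `(c₀, …, c_n) ↦ (lam * c_n, c₀, …, c_{n-1})`. -/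
def IsConstacyclic {F : Type*} [Field F] {n : ℕ} (lam : F)
    (C : Submodule F (Fin (n + 1) → F)) : Prop :=
  ∀ c ∈ C, (Fin.cons (lam * c (Fin.last n)) (fun i : Fin n => c i.castSucc) :
    Fin (n + 1) → F) ∈ C

/-- The (Euclidean) dual code. -/
def dualCode {F : Type*} [Field F] {n : ℕ} (C : Submodule F (Fin n → F)) :
    Submodule F (Fin n → F) where
  carrier := {x | ∀ c ∈ C, ∑ i, c i * x i = 0}
  zero_mem' := by simp
  add_mem' := by
    intro x y hx hy c hc
    simp [mul_add, Finset.sum_add_distrib, hx c hc, hy c hc]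
  smul_mem' := by
    intro a x hx c hc
    have h : ∑ i, c i * (a • x) i = a * ∑ i, c i * x i := by
      rw [Finset.mul_sum]
      exact Finset.sum_congr rfl fun i _ => by simp [mul_left_comm]
    rw [h, hx c hc, mul_zero]

/-- `C`, of length `n`, is an `[n, k, d]` code: it has dimension `k` and minimum Hamming
distance `d`. -/
def HasParameters {F : Type*} [Field F] [DecidableEq F] {n : ℕ} (C : Submodule F (Fin n → F))
    (k d : ℕ) : Prop :=
  Module.finrank F C = k ∧
    IsLeast {e : ℕ | ∃ x ∈ C, ∃ y ∈ C, x ≠ y ∧ hammingDist x y = e} d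

/-- The number `A_w` of codewords of Hamming weight `w`. -/
def weightCount {F : Type*} [Field F] [DecidableEq F] {n : ℕ} (C : Submodule F (Fin n → F))
    (w : ℕ) : ℕ :=
  {c : Fin n → F | c ∈ C ∧ hammingNorm c = w}.ncard

/-- The weight enumerator `∑ A_w z^w`. -/
def weightEnumerator {F : Type*} [Field F] [DecidableEq F] {n : ℕ}
    (C : Submodule F (Fin n → F)) : ℚ[X] :=
  ∑ w ∈ Finset.range (n + 1), Polynomial.C (weightCount C w : ℚ) * X ^ w

/-- The support of a word. -/
def wordSupport {F : Type*} [Field F] [DecidableEq F] {n : ℕ} (c : Fin n → F) : Finset (Fin n) :=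
  Finset.univ.filter fun i => c i ≠ 0

/-- The set of supports of the codewords of weight `w` (without repetition). -/
def blocks {F : Type*} [Field F] [DecidableEq F] {n : ℕ} (C : Submodule F (Fin n → F))
    (w : ℕ) : Set (Finset (Fin n)) :=
  {b | ∃ c ∈ C, hammingNorm c = w ∧ wordSupport c = b}

/-- `(P, B)` is a `t`-`(v, k, η)` design. -/
def IsDesign {P : Type*} [Fintype P] (B : Set (Finset P)) (t v k η : ℕ) : Prop :=
  Fintype.card P = v ∧ 1 ≤ k ∧ k ≤ v ∧ (∀ b ∈ B, b.card = k) ∧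
    ∀ T : Finset P, T.card = t → {b | b ∈ B ∧ T ⊆ b}.ncard = η

/-- The codewords of weight `w` of `C` support a `t`-`(v, w, η)` design. -/
def SupportsDesign {F : Type*} [Field F] [DecidableEq F] {n : ℕ} (C : Submodule F (Fin n → F))
    (t v w η : ℕ) : Prop :=
  1 ≤ t ∧ 1 ≤ η ∧ weightCount C w ≠ 0 ∧ IsDesign (blocks C w) t v w η

end ConstacyclicDesign

end

/-! The code is the code of an elliptic quadric in a Baer subgeometry `PG(3,q)` of `PG(3,q²)`. Write
`φ` for the `q`-Frobenius of `K`. Codewords are the trace words `Tr(a δ⁻ⁱ + b δ^(-(q²+q+1)i))`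
(`codeOfCheck_eq_range`). Since `λ^(q+1) = 1`, some `τ` in `F` satisfies `τ^(q-1) = λ⁻¹`. Then `ζ =
τ δ⁻¹` has `φ ζ = τ δ^(-(q²+q+1))`, so scaling coordinate `i` by `τⁱ` turns a word into `Tr(a ζⁱ + b
φ(ζⁱ))`.

The map `x ↦ (x, φ x)` embeds the four-dimensional `F_q`-space `K` in `K²`, which has dimension four
over `F`. The vectors whose norm to `F` lies in `F_q` form an elliptic quadric with `q² + 1` points.
The powers `ζⁱ` lie on it, and the condition on `ν₂(r)` makes the first `q² + 1` of them distinct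
points, hence all of it. A codeword is a plane of `PG(3,q²)`; it meets the subgeometry in a plane or
a line, hence the quadric in `0`, `1`, `2` or `q + 1` points (`ncard_onQuadric_section`). No three
quadric points are collinear, even over `F` (`quadric_cap`), so the dual distance is at least four.

`IsOvoidCode` records these facts, and the rest is counting. Any three coordinates are the zeros of
a word unique up to scalars, and that word has `q + 1` zeros: these zero sets are the circles of an
inversive plane. The minimum weight supports are their complements, the supports of dual words of
weight four are the concyclic quadruples, and the weight enumerator follows from the binomial
moments of order at most two together with the number of circles. -/

namespace ConstacyclicDesign

open Finset

/-! ### Linear codes: zeros, restriction and duality. -/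

section LinearCode

variable {F : Type*} [Field F] {n : ℕ}

/-- The zero coordinates of a word. -/
def wordZeros [DecidableEq F] (c : Fin n → F) : Finset (Fin n) := univ.filter fun i => c i = 0

lemma mem_wordZeros [DecidableEq F] {c : Fin n → F} {i : Fin n} : i ∈ wordZeros c ↔ c i = 0 := by
  simp [wordZeros]

lemma compl_wordZeros [DecidableEq F] (c : Fin n → F) : (wordZeros c)ᶜ = wordSupport c := by
  ext i; simp [wordZeros, wordSupport]

lemma card_wordSupport [DecidableEq F] (c : Fin n → F) : (wordSupport c).card = hammingNorm c := rfl

lemma card_wordZeros_add_hammingNorm [DecidableEq F] (c : Fin n → F) :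
    (wordZeros c).card + hammingNorm c = n := by
  rw [← card_wordSupport, ← compl_wordZeros, card_add_card_compl, Fintype.card_fin]

lemma wordZeros_zero [DecidableEq F] : wordZeros (0 : Fin n → F) = univ := by
  simp [wordZeros]

/-- The codewords of `C`, as a finset. -/
noncomputable def codewords [Fintype F] (C : Submodule F (Fin n → F)) : Finset (Fin n → F) :=
  letI := Classical.decPred (· ∈ C)
  univ.filter (· ∈ C)

lemma mem_codewords [Fintype F] {C : Submodule F (Fin n → F)} {c : Fin n → F} :
    c ∈ codewords C ↔ c ∈ C := by
  simp [codewords]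

/-- Restriction of codewords to a set of coordinates. -/
def puncture (C : Submodule F (Fin n → F)) (S : Finset (Fin n)) : C →ₗ[F] (S → F) :=
  (LinearMap.funLeft F F (fun i : S => (i : Fin n))).comp C.subtype

lemma puncture_apply (C : Submodule F (Fin n → F)) (S : Finset (Fin n)) (c : C) (i : S) :
    puncture C S c i = (c : Fin n → F) i := rfl

/-- If the restriction to `S` misses some pattern, then a nonzero dual word is supported in `S`. -/
lemma exists_dualCode_of_not_surjective {C : Submodule F (Fin n → F)} {S : Finset (Fin n)}
    (hS : ¬ Function.Surjective (puncture C S)) :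
    ∃ x ∈ dualCode C, x ≠ 0 ∧ ∀ i ∉ S, x i = 0 := by
  classical
  have hlt : (puncture C S).range < ⊤ := by
    rw [lt_top_iff_ne_top]; exact fun h => hS (LinearMap.range_eq_top.1 h)
  obtain ⟨f, hf, hle⟩ := Submodule.exists_le_ker_of_lt_top _ hlt
  refine ⟨fun i => if h : i ∈ S then f (Pi.single ⟨i, h⟩ 1) else 0, ?_, ?_, ?_⟩
  · intro c hc
    have h0 : f (puncture C S ⟨c, hc⟩) = 0 := hle ⟨_, rfl⟩
    rw [LinearMap.pi_apply_eq_sum_univ f] at h0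
    refine Eq.trans ?_ h0
    rw [← Finset.sum_subset (Finset.subset_univ S), ← Finset.sum_coe_sort S]
    · refine Finset.sum_congr rfl fun i _ => ?_
      beta_reduce
      rw [dif_pos i.2, puncture_apply, smul_eq_mul]
      congr 2
      ext j; simp [Pi.single_apply, eq_comm]
    · intro i _ hi; simp [hi]
  · intro h0
    apply hf
    apply LinearMap.pi_ext'
    intro i
    ext
    have := congrFun h0 i
    simpa using this
  · intro i hi; simp [hi]

/-- A word supported in `S` has weight at most the cardinality of `S`. -/
lemma hammingNorm_le_of_support [DecidableEq F] {x : Fin n → F} {S : Finset (Fin n)}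
    (h : ∀ i ∉ S, x i = 0) :
    hammingNorm x ≤ S.card := by
  rw [← card_wordSupport]
  refine Finset.card_le_card fun i hi => ?_
  by_contra hS
  simp [wordSupport, h i hS] at hi

lemma finrank_dualCode (C : Submodule F (Fin n → F)) :
    Module.finrank F (dualCode C) = n - Module.finrank F C := by
  have hB : (dotProductBilin F F : LinearMap.BilinForm F (Fin n → F)).Nondegenerate := by
    constructor
    · intro x hx
      exact dotProduct_eq_zero x fun y => hx y
    · intro x hx
      exact dotProduct_eq_zero x fun y => by rw [dotProduct_comm]; exact hx y
  have h := LinearMap.BilinForm.finrank_orthogonal hB C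
  rw [Module.finrank_fin_fun] at h
  -- `dualCode C` unfolds to the orthogonal complement of `C` for the dot product.
  exact h

/-- The minimum distance of a linear code is its minimum weight. -/
lemma hasParameters_of_minWeight [DecidableEq F] {C : Submodule F (Fin n → F)} {k d : ℕ}
    (hk : Module.finrank F C = k) (hex : ∃ c ∈ C, c ≠ 0 ∧ hammingNorm c = d)
    (hle : ∀ c ∈ C, c ≠ 0 → d ≤ hammingNorm c) : HasParameters C k d := by
  refine ⟨hk, ?_, ?_⟩
  · obtain ⟨c, hc, h0, hd⟩ := hex
    exact ⟨0, C.zero_mem, c, hc, h0.symm, by rw [hammingDist_eq_hammingNorm]; simpa using hd⟩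
  · rintro e ⟨x, hx, y, hy, hxy, rfl⟩
    rw [hammingDist_eq_hammingNorm]
    refine hle _ (C.add_mem (C.neg_mem hx) hy) fun h => hxy ?_
    rwa [neg_add_eq_zero] at h

end LinearCode

/-! ### Ovoid codes: the inversive plane of zero sets and the two designs. -/

section OvoidCode

variable {F : Type*} [Field F] [Fintype F] [DecidableEq F] {q : ℕ}

/-- A four-dimensional code of length `q² + 1` over a field with `q²` elements that has dual
distance at least four and all of whose nonzero words have `0`, `1`, `2` or `q + 1` zeros. Such
codes come from ovoids in Baer subgeometries. -/
structure IsOvoidCode (C : Submodule F (Fin (q ^ 2 + 1) → F)) : Prop where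
  two_lt : 2 < q
  card_field : Fintype.card F = q ^ 2
  finrank_eq : Module.finrank F C = 4
  dual_eq_zero : ∀ x ∈ dualCode C, hammingNorm x ≤ 3 → x = 0
  card_zeros : ∀ c ∈ C, c ≠ 0 → (wordZeros c).card = 0 ∨ (wordZeros c).card = 1 ∨
    (wordZeros c).card = 2 ∨ (wordZeros c).card = q + 1

/-- The codewords with `q + 1` zeros that vanish on `S`. -/
noncomputable def circleWords (C : Submodule F (Fin (q ^ 2 + 1) → F))
    (S : Finset (Fin (q ^ 2 + 1))) : Finset (Fin (q ^ 2 + 1) → F) :=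
  (codewords C).filter fun c => (wordZeros c).card = q + 1 ∧ S ⊆ wordZeros c

variable {C : Submodule F (Fin (q ^ 2 + 1) → F)} {S T : Finset (Fin (q ^ 2 + 1))}

lemma mem_circleWords {c : Fin (q ^ 2 + 1) → F} :
    c ∈ circleWords C S ↔ c ∈ C ∧ (wordZeros c).card = q + 1 ∧ S ⊆ wordZeros c := by
  simp [circleWords, mem_codewords]

namespace IsOvoidCode

lemma surjective_puncture (hC : IsOvoidCode C) (hS : S.card ≤ 3) :
    Function.Surjective (puncture C S) := by
  by_contra h
  obtain ⟨x, hx, h0, hsupp⟩ := exists_dualCode_of_not_surjective h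
  exact h0 (hC.dual_eq_zero x hx ((hammingNorm_le_of_support hsupp).trans hS))

lemma finrank_ker_puncture (hC : IsOvoidCode C) (hS : S.card ≤ 3) :
    Module.finrank F (puncture C S).ker = 4 - S.card := by
  have h := LinearMap.finrank_range_add_finrank_ker (puncture C S)
  rw [LinearMap.range_eq_top.2 (hC.surjective_puncture hS), finrank_top, hC.finrank_eq,
    Module.finrank_fintype_fun_eq_card, Fintype.card_coe] at h
  omega

/-- The number of codewords vanishing on a set of at most three coordinates. -/
lemma card_vanishing (hC : IsOvoidCode C) (hS : S.card ≤ 3) :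
    ((codewords C).filter fun c => S ⊆ wordZeros c).card = (q ^ 2) ^ (4 - S.card) := by
  have h1 := Module.natCard_eq_pow_finrank (K := F) (V := (puncture C S).ker)
  rw [hC.finrank_ker_puncture hS, Nat.card_eq_fintype_card (α := F), hC.card_field] at h1
  rw [← h1, ← Nat.card_eq_finsetCard]
  have hmem : ∀ c : (puncture C S).ker, (c.1 : Fin (q ^ 2 + 1) → F) ∈
      (codewords C).filter fun c => S ⊆ wordZeros c := by
    intro c
    rw [mem_filter, mem_codewords]
    exact ⟨c.1.2, fun i hi => mem_wordZeros.2 (congrFun (LinearMap.mem_ker.1 c.2) ⟨i, hi⟩)⟩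
  refine (Nat.card_congr (Equiv.ofBijective (fun c => ⟨_, hmem c⟩) ⟨?_, ?_⟩)).symm
  · intro c d h
    exact Subtype.ext (Subtype.ext (Subtype.mk.inj h))
  · rintro ⟨c, hc⟩
    rw [mem_filter, mem_codewords] at hc
    refine ⟨⟨⟨c, hc.1⟩, ?_⟩, rfl⟩
    rw [LinearMap.mem_ker]
    ext i
    exact mem_wordZeros.1 (hc.2 i.2)

lemma add_one_lt (hC : IsOvoidCode C) : q + 1 < q ^ 2 + 1 := by
  have := hC.two_lt; nlinarith

lemma ne_zero_of_card (hC : IsOvoidCode C) {c : Fin (q ^ 2 + 1) → F}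
    (hc : (wordZeros c).card = q + 1) : c ≠ 0 := by
  rintro rfl
  rw [wordZeros_zero, card_univ, Fintype.card_fin] at hc
  exact hC.add_one_lt.ne' hc

lemma card_eq_of_three_le (hC : IsOvoidCode C) {c : Fin (q ^ 2 + 1) → F} (hc : c ∈ C) (h0 : c ≠ 0)
    (h3 : 3 ≤ (wordZeros c).card) : (wordZeros c).card = q + 1 := by
  have := hC.card_zeros c hc h0
  omega

/-- Up to scalars a unique nonzero codeword vanishes on three given coordinates. -/
lemma exists_circleWord (hC : IsOvoidCode C) (hS : S.card = 3) :
    ∃ c ∈ circleWords C S, ∀ d ∈ C, S ⊆ wordZeros d → ∃ a : F, d = a • c := by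
  have h1 := hC.finrank_ker_puncture hS.le
  rw [hS] at h1
  obtain ⟨⟨⟨c, hcC⟩, hck⟩, hc0⟩ := 
    (Module.finrank_pos_iff_exists_ne_zero (R := F) (M := (puncture C S).ker)).1 (h1.trans_gt one_pos)
  have hc := exists_smul_eq_of_finrank_eq_one (K := F) (V := (puncture C S).ker) h1 hc0
  have hS0 : S ⊆ wordZeros c := fun i hi => by
    rw [mem_wordZeros]
    exact congrFun (LinearMap.mem_ker.1 hck) ⟨i, hi⟩
  have hne : c ≠ 0 := fun h => hc0 (by ext1; ext1; exact h)
  refine ⟨c, mem_circleWords.2 ⟨hcC, ?_, hS0⟩, fun d hd hdS => ?_⟩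
  · exact hC.card_eq_of_three_le hcC hne (hS ▸ card_le_card hS0)
  · have hdk : (⟨d, hd⟩ : C) ∈ (puncture C S).ker := by
      rw [LinearMap.mem_ker]
      ext i
      exact mem_wordZeros.1 (hdS i.2)
    obtain ⟨a, ha⟩ := hc ⟨_, hdk⟩
    refine ⟨a, ?_⟩
    have := congrArg (fun z : (puncture C S).ker => ((z : C) : Fin (q ^ 2 + 1) → F)) ha
    exact this.symm

/-- The words vanishing on `S` form a line over `F`, and each of its nonzero members has `q + 1`
zeros. -/
lemma card_circleWords_three (hC : IsOvoidCode C) (hS : S.card = 3) :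
    (circleWords C S).card = q ^ 2 - 1 := by
  have h := hC.card_vanishing hS.le
  have : circleWords C S = ((codewords C).filter fun c => S ⊆ wordZeros c).erase 0 := by
    ext c
    simp only [mem_circleWords, mem_erase, mem_filter, mem_codewords]
    refine ⟨fun ⟨h1, h2, h3⟩ => ⟨hC.ne_zero_of_card h2, h1, h3⟩, fun ⟨h1, h2, h3⟩ => ⟨h2, ?_, h3⟩⟩
    exact hC.card_eq_of_three_le h2 h1 (hS ▸ card_le_card h3)
  rw [this, card_erase_of_mem, h, hS]
  · simp
  · simp [mem_codewords, wordZeros_zero, C.zero_mem]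

/-- Double counting of the pairs of a word vanishing on `S` and a further zero of it. -/
lemma card_circleWords_mul {N : ℕ}
    (hN : ∀ i ∉ S, (circleWords C (insert i S)).card = N) :
    (circleWords C S).card * (q + 1 - S.card) = (q ^ 2 + 1 - S.card) * N := by
  have h := Finset.sum_card_bipartiteAbove_eq_sum_card_bipartiteBelow
    (s := circleWords C S) (t := Sᶜ) (fun c i => c i = 0)
  rw [sum_const_nat (m := q + 1 - S.card), sum_const_nat (m := N), card_compl,
    Fintype.card_fin] at h
  · exact h
  · intro i hi
    rw [← hN i (mem_compl.1 hi)]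
    congr 1
    ext c
    simp only [bipartiteBelow, mem_filter, mem_circleWords, insert_subset_iff, mem_wordZeros]
    tauto
  · intro c hc
    obtain ⟨-, h1, h2⟩ := mem_circleWords.1 hc
    rw [← h1, ← card_sdiff_of_subset h2]
    congr 1
    ext i
    simp only [bipartiteAbove, mem_filter, mem_compl, mem_sdiff, mem_wordZeros]
    tauto

/-- Start of a descent: double counting passes from the count for three prescribed zeros to two,
then one, then none. -/
lemma card_circleWords_two (hC : IsOvoidCode C) (hS : S.card = 2) :
    (circleWords C S).card = (q ^ 2 - 1) * (q + 1) := by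
  have h2 := hC.two_lt
  have h := card_circleWords_mul (C := C) (S := S) (N := q ^ 2 - 1) fun i hi =>
    hC.card_circleWords_three (by rw [card_insert_of_notMem hi, hS])
  rw [hS] at h
  have e1 : q ^ 2 + 1 - 2 = (q + 1) * (q - 1) := by
    rw [← Nat.sq_sub_sq q 1]; simp
  have e2 : q + 1 - 2 = q - 1 := by omega
  rw [e1, e2] at h
  apply Nat.eq_of_mul_eq_mul_right (show 0 < q - 1 by omega)
  rw [h]; ring

lemma card_circleWords_one (hC : IsOvoidCode C) (hS : S.card = 1) :
    (circleWords C S).card = (q ^ 2 - 1) * (q + 1) * q := by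
  have h2 := hC.two_lt
  have h := card_circleWords_mul (C := C) (S := S) fun i hi =>
    hC.card_circleWords_two (by rw [card_insert_of_notMem hi, hS])
  rw [hS, Nat.add_sub_cancel, Nat.add_sub_cancel] at h
  apply Nat.eq_of_mul_eq_mul_right (show 0 < q by omega)
  rw [h]; ring

lemma card_circleWords_empty (hC : IsOvoidCode C) :
    (circleWords C ∅).card = (q ^ 2 - 1) * q * (q ^ 2 + 1) := by
  have h2 := hC.two_lt
  have h := card_circleWords_mul (C := C) (S := ∅) fun i hi =>
    hC.card_circleWords_one (by simp)
  rw [card_empty, Nat.sub_zero, Nat.sub_zero] at h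
  apply Nat.eq_of_mul_eq_mul_right (show 0 < q + 1 by omega)
  rw [h]; ring

/-- The number of words with `q + 1` zeros, none of them in a given set of three coordinates. -/
lemma card_circleWords_disjoint (hC : IsOvoidCode C) (hT : T.card = 3) :
    ((circleWords C ∅).filter fun c => T ⊆ wordSupport c).card =
      (q ^ 2 - 1) * ((q ^ 2 - q - 1) * (q - 2)) := by
  obtain ⟨x, y, z, hxy, hxz, hyz, rfl⟩ := card_eq_three.1 hT
  have hcount : ∀ S : Finset (Fin (q ^ 2 + 1)), ((circleWords C ∅).filter
      fun c => ∀ i ∈ S, c i = 0).card = (circleWords C S).card := by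
    intro S
    congr 1
    ext c
    simp only [mem_filter, mem_circleWords, empty_subset, and_true, and_assoc]
    simp only [subset_iff, mem_wordZeros]
  have h1x := hcount {x}
  have h1y := hcount {y}
  have h1z := hcount {z}
  have h2xy := hcount {x, y}
  have h2xz := hcount {x, z}
  have h2yz := hcount {y, z}
  have h3 := hcount {x, y, z}
  rw [hC.card_circleWords_one (by simp)] at h1x h1y h1z
  rw [hC.card_circleWords_two (card_pair ‹_›)] at h2xy h2xz h2yz
  rw [hC.card_circleWords_three hT] at h3
  have h0 := hC.card_circleWords_empty
  simp only [mem_insert, mem_singleton, forall_eq_or_imp, forall_eq] at h1x h1y h1z h2xy h2xz h2yz h3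
  -- Inclusion–exclusion over the three coordinates, with negative terms moved across because the
  -- counts are natural numbers.
  have hincl : ((circleWords C ∅).filter fun c => {x, y, z} ⊆ wordSupport c).card
      + ((circleWords C ∅).filter fun c => c x = 0).card
      + ((circleWords C ∅).filter fun c => c y = 0).card
      + ((circleWords C ∅).filter fun c => c z = 0).card
      + ((circleWords C ∅).filter fun c => c x = 0 ∧ c y = 0 ∧ c z = 0).card
      = (circleWords C ∅).card + ((circleWords C ∅).filter fun c => c x = 0 ∧ c y = 0).card
      + ((circleWords C ∅).filter fun c => c x = 0 ∧ c z = 0).card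
      + ((circleWords C ∅).filter fun c => c y = 0 ∧ c z = 0).card := by
    simp only [card_filter, card_eq_sum_ones (circleWords C ∅), ← sum_add_distrib]
    refine sum_congr rfl fun c _ => ?_
    simp only [insert_subset_iff, singleton_subset_iff, wordSupport, mem_filter, mem_univ, true_and]
    by_cases hx : c x = 0 <;> by_cases hy : c y = 0 <;> by_cases hz : c z = 0 <;> simp [hx, hy, hz]
  rw [h1x, h1y, h1z, h2xy, h2xz, h2yz, h3, h0] at hincl
  have h2 := hC.two_lt
  -- The shift removes the truncated subtractions; the common factor `q² - 1` then becomes an atom.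
  obtain ⟨k, rfl⟩ : ∃ k, q = k + 3 := ⟨q - 3, by omega⟩
  have a1 : (k + 3) ^ 2 - (k + 3) - 1 = k ^ 2 + 5 * k + 5 := by
    rw [Nat.sub_sub]; apply Nat.sub_eq_of_eq_add; ring
  have a2 : k + 3 - 2 = k + 1 := by omega
  rw [a1, a2]
  generalize (k + 3) ^ 2 - 1 = M at hincl ⊢
  nlinarith [hincl]

/-- Words with `q + 1` zeros that share three zeros have the same zeros. -/
lemma wordZeros_eq (hC : IsOvoidCode C) (hS : S.card = 3) {c d : Fin (q ^ 2 + 1) → F}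
    (hc : c ∈ circleWords C S) (hd : d ∈ circleWords C S) : wordZeros c = wordZeros d := by
  obtain ⟨e, -, he⟩ := hC.exists_circleWord hS
  rw [mem_circleWords] at hc hd
  obtain ⟨a, rfl⟩ := he c hc.1 hc.2.2
  obtain ⟨b, rfl⟩ := he d hd.1 hd.2.2
  have ha : a ≠ 0 := fun h => hC.ne_zero_of_card hc.2.1 (by simp [h])
  have hb : b ≠ 0 := fun h => hC.ne_zero_of_card hd.2.1 (by simp [h])
  ext i
  simp [mem_wordZeros, ha, hb]

lemma hammingNorm_eq_iff (hC : IsOvoidCode C) {c : Fin (q ^ 2 + 1) → F} :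
    hammingNorm c = q ^ 2 - q ↔ (wordZeros c).card = q + 1 := by
  have h1 := card_wordZeros_add_hammingNorm c
  have h2 := hC.add_one_lt
  omega

/-- Each block is the support of exactly `q² - 1` words, since three of its missing points already
determine the word up to scalars. So the number of words is divided by `q² - 1`. -/
lemma ncard_blocks_superset (hC : IsOvoidCode C) (hT : T.card = 3) :
    {b | b ∈ blocks C (q ^ 2 - q) ∧ T ⊆ b}.ncard = (q ^ 2 - q - 1) * (q - 2) := by
  set W := (circleWords C ∅).filter fun c => T ⊆ wordSupport c with hW
  have hset : {b | b ∈ blocks C (q ^ 2 - q) ∧ T ⊆ b} = (W.image wordSupport : Finset _) := by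
    ext b
    simp only [blocks, Set.mem_ofPred_eq, coe_image, Set.mem_image, mem_coe, hW, mem_filter,
      mem_circleWords, empty_subset, and_true, hC.hammingNorm_eq_iff]
    constructor
    · rintro ⟨⟨c, h1, h2, rfl⟩, h3⟩
      exact ⟨c, ⟨⟨h1, h2⟩, h3⟩, rfl⟩
    · rintro ⟨c, ⟨⟨h1, h2⟩, h3⟩, rfl⟩
      exact ⟨⟨c, h1, h2, rfl⟩, h3⟩
  rw [hset, Set.ncard_coe_finset]
  have hcard := Finset.card_eq_sum_card_image wordSupport W
  rw [sum_const_nat (m := q ^ 2 - 1), hW, hC.card_circleWords_disjoint hT] at hcard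
  · have : 0 < q ^ 2 - 1 := by have := hC.two_lt; have := hC.add_one_lt; omega
    rw [mul_comm] at hcard
    exact (Nat.eq_of_mul_eq_mul_right this hcard).symm
  · intro b hb
    obtain ⟨c, hc, rfl⟩ := mem_image.1 hb
    obtain ⟨hc1, hc2⟩ := mem_filter.1 hc
    rw [mem_circleWords] at hc1
    obtain ⟨S, hSc, hS⟩ := exists_subset_card_eq (show 3 ≤ (wordZeros c).card by
      have := hC.two_lt; omega)
    rw [← hC.card_circleWords_three hS]
    congr 1
    ext d
    simp only [mem_filter, hW]
    constructor
    · rintro ⟨⟨h1, h2⟩, h3⟩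
      rw [mem_circleWords] at h1 ⊢
      rw [← compl_wordZeros, ← compl_wordZeros, compl_inj_iff] at h3
      exact ⟨h1.1, h1.2.1, h3 ▸ hSc⟩
    · intro h
      have h3 := hC.wordZeros_eq hS h (mem_circleWords.2 ⟨hc1.1, hc1.2.1, hSc⟩)
      have h4 : wordSupport d = wordSupport c := by
        rw [← compl_wordZeros, ← compl_wordZeros, h3]
      rw [mem_circleWords] at h
      exact ⟨⟨mem_circleWords.2 ⟨h.1, h.2.1, empty_subset _⟩, h4 ▸ hc2⟩, h4⟩

lemma weightCount_circle (hC : IsOvoidCode C) :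
    weightCount C (q ^ 2 - q) = (q ^ 2 - 1) * q * (q ^ 2 + 1) := by
  rw [← hC.card_circleWords_empty, weightCount, ← Set.ncard_coe_finset]
  congr 1
  ext c
  simp [mem_circleWords, hC.hammingNorm_eq_iff]

theorem supportsDesign (hC : IsOvoidCode C) :
    SupportsDesign C 3 (q ^ 2 + 1) (q ^ 2 - q) ((q ^ 2 - q - 1) * (q - 2)) := by
  have h2 := hC.two_lt
  have h3 : q + q + 1 ≤ q ^ 2 := by nlinarith
  refine ⟨by norm_num, Nat.mul_pos (by omega) (by omega), ?_, Fintype.card_fin _, by omega,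
    by omega, ?_, fun T hT => hC.ncard_blocks_superset hT⟩
  · rw [hC.weightCount_circle]
    have : 0 < q ^ 2 - 1 := by omega
    positivity
  · rintro b ⟨c, -, hc, rfl⟩
    exact hc

theorem hasParameters (hC : IsOvoidCode C) : HasParameters C 4 (q ^ 2 - q) := by
  refine hasParameters_of_minWeight hC.finrank_eq ?_ fun c hc h0 => ?_
  · have h : 0 < (circleWords C ∅).card := by
      have := hC.add_one_lt
      have h1 : 0 < q ^ 2 - 1 := by have := hC.two_lt; omega
      have := hC.two_lt
      rw [hC.card_circleWords_empty]; positivity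
    obtain ⟨c, hc⟩ := card_pos.1 h
    rw [mem_circleWords] at hc
    exact ⟨c, hc.1, hC.ne_zero_of_card hc.2.1, hC.hammingNorm_eq_iff.2 hc.2.1⟩
  · have h1 := card_wordZeros_add_hammingNorm c
    have h2 := hC.card_zeros c hc h0
    have := hC.two_lt
    omega

/-- Four coordinates support a dual word of weight four exactly when they are zeros of a common
nonzero codeword. -/
lemma insert_mem_blocks_dualCode (hC : IsOvoidCode C) (hT : T.card = 3)
    {c : Fin (q ^ 2 + 1) → F} (hc : c ∈ circleWords C T) {i : Fin (q ^ 2 + 1)} (hi : i ∉ T) :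
    insert i T ∈ blocks (dualCode C) 4 ↔ c i = 0 := by
  have hcard : (insert i T).card = 4 := by rw [card_insert_of_notMem hi, hT]
  have hc' := mem_circleWords.1 hc
  constructor
  · rintro ⟨x, hx, -, hsupp⟩
    have h0 := hx c hc'.1
    rw [sum_eq_single i] at h0
    · have : i ∈ wordSupport x := hsupp ▸ mem_insert_self i T
      simp only [wordSupport, mem_filter, mem_univ, true_and] at this
      exact (mul_eq_zero.1 h0).resolve_right this
    · intro j _ hj
      by_cases hjT : j ∈ T
      · rw [mem_wordZeros.1 (hc'.2.2 hjT), zero_mul]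
      · have : j ∉ wordSupport x := by rw [hsupp]; simp [hj, hjT]
        simp only [wordSupport, mem_filter, mem_univ, true_and, not_not] at this
        rw [this, mul_zero]
    · simp
  · intro h0
    have hns : ¬ Function.Surjective (puncture C (insert i T)) := by
      intro hs
      -- Between spaces of dimension four a surjection is injective, but `c` lies in the kernel.
      have hdim : Module.finrank F C = Module.finrank F (↥(insert i T) → F) := by
        rw [hC.finrank_eq, Module.finrank_fintype_fun_eq_card, Fintype.card_coe, hcard]
      have hinj := (LinearMap.injective_iff_surjective_of_finrank_eq_finrank hdim).2 hs
      refine hC.ne_zero_of_card hc'.2.1 ?_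
      have : (⟨c, hc'.1⟩ : C) = 0 := by
        apply hinj
        rw [map_zero]
        ext j
        rw [puncture_apply]
        rcases mem_insert.1 j.2 with hj | hj
        · rw [hj]; exact h0
        · exact mem_wordZeros.1 (hc'.2.2 hj)
      exact congrArg Subtype.val this
    obtain ⟨x, hx, hx0, hsupp⟩ := exists_dualCode_of_not_surjective hns
    have hsub : wordSupport x ⊆ insert i T := by
      intro j hj
      by_contra h
      simp [wordSupport, hsupp j h] at hj
    have h4 : 4 ≤ hammingNorm x := by
      by_contra h
      exact hx0 (hC.dual_eq_zero x hx (by omega))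
    have heq := eq_of_subset_of_card_le hsub (by rw [hcard, card_wordSupport]; exact h4)
    exact ⟨x, hx, by rw [← card_wordSupport, heq, hcard], heq⟩

/-- The fourth point may be any of the `q + 1 - 3` remaining points of the circle through `T`. -/
lemma ncard_blocks_dualCode_superset (hC : IsOvoidCode C) (hT : T.card = 3) :
    {b | b ∈ blocks (dualCode C) 4 ∧ T ⊆ b}.ncard = q - 2 := by
  obtain ⟨c, hc, -⟩ := hC.exists_circleWord hT
  have hc' := mem_circleWords.1 hc
  have hset : {b | b ∈ blocks (dualCode C) 4 ∧ T ⊆ b} =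
      ((wordZeros c \ T).image fun i => insert i T : Finset _) := by
    ext b
    simp only [Set.mem_ofPred_eq, coe_image, Set.mem_image, mem_coe, mem_sdiff, mem_wordZeros]
    constructor
    · rintro ⟨hb, hTb⟩
      have hb4 : b.card = 4 := by obtain ⟨x, -, h4, rfl⟩ := hb; exact h4
      obtain ⟨i, hi⟩ := card_eq_one.1
        (show (b \ T).card = 1 by rw [card_sdiff_of_subset hTb, hb4, hT])
      have hiT : i ∉ T := (mem_sdiff.1 (hi ▸ mem_singleton_self i)).2
      have hbi : insert i T = b := by
        rw [insert_eq, ← hi, sdiff_union_of_subset hTb]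
      rw [← hbi] at hb
      exact ⟨i, ⟨(hC.insert_mem_blocks_dualCode hT hc hiT).1 hb, hiT⟩, hbi⟩
    · rintro ⟨i, ⟨h0, hiT⟩, rfl⟩
      exact ⟨(hC.insert_mem_blocks_dualCode hT hc hiT).2 h0, subset_insert _ _⟩
  rw [hset, Set.ncard_coe_finset, card_image_of_injOn, card_sdiff_of_subset hc'.2.2, hc'.2.1, hT]
  · omega
  · intro i hi j hj hij
    have hiT := (mem_sdiff.1 hi).2
    have : i ∈ insert j T :=
      (show insert i T = insert j T from hij) ▸ mem_insert_self i T
    exact (mem_insert.1 this).resolve_right hiT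

lemma exists_dualCode_four (hC : IsOvoidCode C) :
    ∃ x ∈ dualCode C, hammingNorm x = 4 := by
  have h2 := hC.two_lt
  obtain ⟨T, -, hT⟩ := exists_subset_card_eq (s := (univ : Finset (Fin (q ^ 2 + 1)))) (n := 3)
    (by rw [card_univ, Fintype.card_fin]; nlinarith)
  have h := hC.ncard_blocks_dualCode_superset hT
  obtain ⟨b, ⟨x, hx, h4, -⟩, -⟩ := Set.nonempty_of_ncard_ne_zero (h.trans_ne (by omega))
  exact ⟨x, hx, h4⟩

theorem hasParameters_dualCode (hC : IsOvoidCode C) :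
    HasParameters (dualCode C) (q ^ 2 - 3) 4 := by
  refine hasParameters_of_minWeight ?_ ?_ fun x hx h0 => ?_
  · rw [finrank_dualCode, hC.finrank_eq]; omega
  · obtain ⟨x, hx, h4⟩ := hC.exists_dualCode_four
    exact ⟨x, hx, fun h => by simp [h] at h4, h4⟩
  · by_contra h
    exact h0 (hC.dual_eq_zero x hx (by omega))

theorem supportsDesign_dualCode (hC : IsOvoidCode C) :
    SupportsDesign (dualCode C) 3 (q ^ 2 + 1) 4 (q - 2) := by
  have h2 := hC.two_lt
  have h3 : 3 ≤ q ^ 2 := by nlinarith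
  refine ⟨by norm_num, by omega, ?_, Fintype.card_fin _, by omega, by omega, ?_,
    fun T hT => hC.ncard_blocks_dualCode_superset hT⟩
  · obtain ⟨x, hx, h4⟩ := hC.exists_dualCode_four
    exact Set.ncard_ne_zero_of_mem (show x ∈ _ from ⟨hx, h4⟩)
  · rintro b ⟨c, -, hc, rfl⟩
    exact hc

end IsOvoidCode

end OvoidCode

/-! ### Weight enumerator of an ovoid code. -/

section OvoidCode

variable {F : Type*} [Field F] [Fintype F] [DecidableEq F] {q : ℕ}
  {C : Submodule F (Fin (q ^ 2 + 1) → F)}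

/-- The number of codewords with `k` zeros. -/
noncomputable def zerosCount (C : Submodule F (Fin (q ^ 2 + 1) → F)) (k : ℕ) : ℕ :=
  ((codewords C).filter fun c => (wordZeros c).card = k).card

lemma weightCount_eq_zerosCount {w k : ℕ} (h : w + k = q ^ 2 + 1) :
    weightCount C w = zerosCount C k := by
  rw [zerosCount, weightCount, ← Set.ncard_coe_finset]
  congr 1
  ext c
  have := card_wordZeros_add_hammingNorm c
  simp only [Set.mem_ofPred_eq, coe_filter, mem_codewords]
  refine and_congr_right fun _ => ?_
  omega

namespace IsOvoidCode

/-- Double counting of words with a `j`-set of their zeros. Dual distance at least four makes the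
number of words independent of the `j`-set for `j ≤ 3`. -/
lemma sum_choose_card_wordZeros (hC : IsOvoidCode C) {j : ℕ} (hj : j ≤ 3) :
    ∑ c ∈ codewords C, (wordZeros c).card.choose j =
      (q ^ 2 + 1).choose j * (q ^ 2) ^ (4 - j) := by
  have h := Finset.sum_card_bipartiteAbove_eq_sum_card_bipartiteBelow
    (s := codewords C) (t := powersetCard j (univ : Finset (Fin (q ^ 2 + 1))))
    (fun c S => S ⊆ wordZeros c)
  rw [sum_const_nat (s := powersetCard j univ) (m := (q ^ 2) ^ (4 - j)), card_powersetCard,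
    card_univ, Fintype.card_fin] at h
  · rw [← h]
    refine sum_congr rfl fun c _ => ?_
    rw [← card_powersetCard]
    congr 1
    ext S
    simp only [bipartiteAbove, mem_filter, mem_powersetCard, subset_univ, true_and]
    tauto
  · intro S hS
    rw [mem_powersetCard] at hS
    exact (hC.card_vanishing (hS.2.trans_le hj)).trans (by rw [hS.2])

lemma card_wordZeros_mem (hC : IsOvoidCode C) {c : Fin (q ^ 2 + 1) → F} (hc : c ∈ C) :
    (wordZeros c).card ∈ ({0, 1, 2, q + 1, q ^ 2 + 1} : Finset ℕ) := by
  simp only [mem_insert, mem_singleton]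
  by_cases h0 : c = 0
  · simp [h0, wordZeros_zero]
  · have := hC.card_zeros c hc h0
    tauto

lemma zerosCount_full (hC : IsOvoidCode C) : zerosCount C (q ^ 2 + 1) = 1 := by
  rw [zerosCount, card_eq_one]
  refine ⟨0, ?_⟩
  ext c
  simp only [mem_filter, mem_codewords, mem_singleton]
  constructor
  · rintro ⟨hc, h⟩
    by_contra h0
    have := hC.card_zeros c hc h0
    have := hC.add_one_lt
    have := hC.two_lt
    omega
  · rintro rfl
    exact ⟨C.zero_mem, by simp [wordZeros_zero]⟩

/-- Sums over codewords of a function of the number of zeros. -/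
lemma sum_codewords (hC : IsOvoidCode C) (g : ℕ → ℕ) :
    ∑ c ∈ codewords C, g (wordZeros c).card =
      zerosCount C 0 * g 0 + zerosCount C 1 * g 1 + zerosCount C 2 * g 2 +
        zerosCount C (q + 1) * g (q + 1) + g (q ^ 2 + 1) := by
  have h1 := hC.add_one_lt
  have h2 := hC.two_lt
  have hfib : ∀ k, ∑ c ∈ codewords C with (wordZeros c).card = k, g (wordZeros c).card =
      zerosCount C k * g k := by
    intro k
    exact sum_const_nat fun c hc => by rw [(mem_filter.1 hc).2]
  rw [← sum_fiberwise_of_maps_to (g := fun c => (wordZeros c).card)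
    fun c hc => hC.card_wordZeros_mem (mem_codewords.1 hc)]
  simp only [hfib]
  rw [sum_insert, sum_insert, sum_insert, sum_insert, sum_singleton, hC.zerosCount_full]
  · ring
  all_goals simp only [mem_insert, mem_singleton]; omega

lemma zerosCount_circle (hC : IsOvoidCode C) : (zerosCount C (q + 1) : ℚ) = (q : ℚ) ^ 5 - q := by
  have h1 := hC.add_one_lt
  have h2 := hC.two_lt
  rw [← weightCount_eq_zerosCount (w := q ^ 2 - q) (by omega), hC.weightCount_circle]
  push_cast [Nat.cast_sub (show 1 ≤ q ^ 2 by omega)]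
  ring

/-- The moment system is triangular: `k.choose 2` kills the words with at most one zero, so order
two gives this count; orders one and zero then give the other two. -/
lemma zerosCount_two (hC : IsOvoidCode C) :
    (zerosCount C 2 : ℚ) = ((q : ℚ) ^ 4 - 1) * (q - 1) * q ^ 3 / 2 := by
  have h := hC.sum_choose_card_wordZeros (j := 2) (by norm_num)
  rw [hC.sum_codewords fun k => k.choose 2] at h
  have h' := congrArg (Nat.cast : ℕ → ℚ) h
  push_cast [Nat.cast_choose_two, hC.zerosCount_circle] at h'
  linear_combination h'

lemma zerosCount_one (hC : IsOvoidCode C) :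
    (zerosCount C 1 : ℚ) = (q : ℚ) ^ 7 - q ^ 5 + q ^ 4 - q ^ 3 + q - 1 := by
  have h := hC.sum_choose_card_wordZeros (j := 1) (by norm_num)
  rw [hC.sum_codewords fun k => k.choose 1] at h
  have h' := congrArg (Nat.cast : ℕ → ℚ) h
  simp only [Nat.choose_one_right] at h'
  push_cast [hC.zerosCount_circle, hC.zerosCount_two] at h'
  linear_combination h'

lemma zerosCount_zero (hC : IsOvoidCode C) :
    (zerosCount C 0 : ℚ) = ((q : ℚ) ^ 4 - 1) * (q - 1) * q ^ 3 / 2 := by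
  have h := hC.sum_choose_card_wordZeros (j := 0) (by norm_num)
  rw [hC.sum_codewords fun k => k.choose 0] at h
  have h' := congrArg (Nat.cast : ℕ → ℚ) h
  simp only [Nat.choose_zero_right] at h'
  push_cast [hC.zerosCount_circle, hC.zerosCount_two, hC.zerosCount_one] at h'
  linear_combination h'

theorem weightEnumerator_eq (hC : IsOvoidCode C) :
    weightEnumerator C =
      1 + Polynomial.C ((q : ℚ) ^ 5 - q) * X ^ (q ^ 2 - q)
        + Polynomial.C (((q : ℚ) ^ 4 - 1) * (q - 1) * q ^ 3 / 2) *
          (X ^ (q ^ 2 - 1) + X ^ (q ^ 2 + 1))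
        + Polynomial.C ((q : ℚ) ^ 7 - q ^ 5 + q ^ 4 - q ^ 3 + q - 1) * X ^ (q ^ 2) := by
  have h1 := hC.add_one_lt
  have h2 := hC.two_lt
  have hsub : ({0, q ^ 2 - q, q ^ 2 - 1, q ^ 2, q ^ 2 + 1} : Finset ℕ) ⊆
      range (q ^ 2 + 1 + 1) := by
    intro w hw
    simp only [mem_insert, mem_singleton] at hw
    rw [mem_range]
    omega
  rw [weightEnumerator, ← sum_subset hsub]
  · rw [sum_insert, sum_insert, sum_insert, sum_insert, sum_singleton,
      weightCount_eq_zerosCount (w := 0) (k := q ^ 2 + 1) (by omega),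
      weightCount_eq_zerosCount (w := q ^ 2 - q) (k := q + 1) (by omega),
      weightCount_eq_zerosCount (w := q ^ 2 - 1) (k := 2) (by omega),
      weightCount_eq_zerosCount (w := q ^ 2) (k := 1) (by omega),
      weightCount_eq_zerosCount (w := q ^ 2 + 1) (k := 0) (by omega),
      hC.zerosCount_full, hC.zerosCount_circle, hC.zerosCount_two, hC.zerosCount_one,
      hC.zerosCount_zero]
    · simp only [Nat.cast_one, map_one, pow_zero]
      ring
    all_goals simp only [mem_insert, mem_singleton]; omega
  · intro w hw hw'
    rw [mem_range] at hw
    have h0 : zerosCount C (q ^ 2 + 1 - w) = 0 := by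
      rw [zerosCount, card_eq_zero, filter_eq_empty_iff]
      intro c hc h
      have := hC.card_wordZeros_mem (mem_codewords.1 hc)
      simp only [mem_insert, mem_singleton] at this hw'
      omega
    rw [weightCount_eq_zerosCount (k := q ^ 2 + 1 - w) (by omega), h0]
    simp

end IsOvoidCode

end OvoidCode

/-! ### The elliptic quadric: tangent plane, lines and the cap property. -/

section Quadric

variable {K : Type*} [Field K] (φ : K →+* K)

/-- The trace to the fixed field of `φ²`, when `φ` has order four. -/
def quadTrace : K →+ K := AddMonoidHom.id K + (φ.comp φ).toAddMonoidHom

lemma quadTrace_apply (x : K) : quadTrace φ x = x + φ (φ x) := rfl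

/-- The norm to the fixed field of `φ²`, when `φ` has order four. -/
def quadNorm : K →* K := MonoidHom.id K * (φ.comp φ).toMonoidHom

lemma quadNorm_apply (x : K) : quadNorm φ x = x * φ (φ x) := rfl

/-- The vectors on the elliptic quadric: those with norm in the fixed field of `φ`. -/
def OnQuadric (x : K) : Prop := x ≠ 0 ∧ φ (quadNorm φ x) = quadNorm φ x

variable {φ}

/-- The norm is multiplicative, so the quadric vectors form a group. Multiplication moves any point
to `1`, hence only the tangent plane at `1` is studied. -/
lemma OnQuadric.mul {x y : K} (hx : OnQuadric φ x) (hy : OnQuadric φ y) : OnQuadric φ (x * y) :=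
  ⟨mul_ne_zero hx.1 hy.1, by simp only [map_mul, hx.2, hy.2]⟩

lemma OnQuadric.inv {x : K} (hx : OnQuadric φ x) : OnQuadric φ x⁻¹ :=
  ⟨inv_ne_zero hx.1, by
    have h : quadNorm φ x⁻¹ = (quadNorm φ x)⁻¹ := by simp [quadNorm_apply, mul_comm]
    rw [h, map_inv₀, hx.2]⟩

lemma OnQuadric.pow {x : K} (hx : OnQuadric φ x) (i : ℕ) : OnQuadric φ (x ^ i) :=
  ⟨pow_ne_zero _ hx.1, by simp only [map_pow, hx.2]⟩

lemma OnQuadric.of_fixed {s : K} (hs : φ s = s) (h0 : s ≠ 0) : OnQuadric φ s :=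
  ⟨h0, by simp [quadNorm_apply, hs]⟩

/-- The point `1` is the only point of the quadric on its tangent plane. -/
lemma OnQuadric.fixed_of_tangent {x : K} (hx : OnQuadric φ x)
    (ht : φ (quadTrace φ x) = quadTrace φ x) : φ x = x := by
  have hn := hx.2
  rw [quadNorm_apply, map_mul] at hn
  rw [quadTrace_apply, map_add] at ht
  -- With trace and norm fixed by `φ`, the element `φ x` is again a root of `(t - x)(t - φ² x)`.
  have h : (φ x - x) * (φ x - φ (φ x)) = 0 := by linear_combination φ x * ht - hn
  rcases mul_eq_zero.1 h with h | h
  · exact sub_eq_zero.1 h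
  · exact (φ.injective (sub_eq_zero.1 h)).symm

lemma quadNorm_add_fixed {x s : K} (hs : φ s = s) :
    quadNorm φ (x + s) = quadNorm φ x + s * quadTrace φ x + s ^ 2 := by
  simp only [quadNorm_apply, quadTrace_apply, map_add, hs]; ring

lemma quadTrace_add_fixed {x s : K} (hs : φ s = s) :
    φ (quadTrace φ (x + s)) - quadTrace φ (x + s) = φ (quadTrace φ x) - quadTrace φ x := by
  simp only [quadTrace_apply, map_add, hs]; ring

/-- The terms in `s²` cancel because `1` is on the quadric. Along a line through `1` the quadric
equation is therefore affine in `s`, with slope the tangent form. -/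
lemma map_quadNorm_add_fixed {x s : K} (hs : φ s = s) :
    φ (quadNorm φ (x + s)) - quadNorm φ (x + s) = φ (quadNorm φ x) - quadNorm φ x +
      s * (φ (quadTrace φ x) - quadTrace φ x) := by
  rw [quadNorm_add_fixed hs]
  simp only [map_add, map_mul, map_pow, hs]; ring

/-- A line through the point `1` meets the quadric in at most one further point. -/
lemma OnQuadric.eq_zero_of_add {x s : K} (hx : OnQuadric φ x) (hxs : OnQuadric φ (x + s))
    (hs : φ s = s) (hfix : φ x ≠ x) : s = 0 := by
  have h := map_quadNorm_add_fixed (φ := φ) (x := x) hs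
  rw [hx.2, hxs.2, sub_self, sub_self, zero_add] at h
  rcases mul_eq_zero.1 h.symm with h | h
  · exact h
  · exact absurd (hx.fixed_of_tangent (sub_eq_zero.1 h)) hfix

/-- Tangent form and quadric equation both take values negated by `φ`, so their quotients are fixed
by `φ`. -/
lemma quad_antifixed_trace (h4 : ∀ x, φ (φ (φ (φ x))) = x) (x : K) :
    φ (φ (quadTrace φ x) - quadTrace φ x) = -(φ (quadTrace φ x) - quadTrace φ x) := by
  simp only [quadTrace_apply, map_add, map_sub, h4]; ring

lemma quad_antifixed_norm (h4 : ∀ x, φ (φ (φ (φ x))) = x) (x : K) :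
    φ (φ (quadNorm φ x) - quadNorm φ x) = -(φ (quadNorm φ x) - quadNorm φ x) := by
  simp only [quadNorm_apply, map_mul, map_sub, h4]; ring

/-- A line through `1` that is not tangent meets the quadric in a further point. -/
lemma exists_onQuadric_add (h4 : ∀ x, φ (φ (φ (φ x))) = x) {x : K}
    (ht : φ (quadTrace φ x) ≠ quadTrace φ x) : ∃ s, φ s = s ∧ OnQuadric φ (x + s) := by
  have ht' : φ (quadTrace φ x) - quadTrace φ x ≠ 0 := sub_ne_zero.2 ht
  -- The parameter is the root of the affine equation of `map_quadNorm_add_fixed`.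
  have hs : φ (-((φ (quadNorm φ x) - quadNorm φ x) / (φ (quadTrace φ x) - quadTrace φ x))) =
      -((φ (quadNorm φ x) - quadNorm φ x) / (φ (quadTrace φ x) - quadTrace φ x)) := by
    rw [map_neg, map_div₀, quad_antifixed_norm h4, quad_antifixed_trace h4, neg_div_neg_eq]
  refine ⟨_, hs, ?_, ?_⟩
  · intro h0
    have h := quadTrace_add_fixed (x := x) hs
    rw [h0, map_zero, map_zero, sub_zero] at h
    exact ht' h.symm
  · have h := map_quadNorm_add_fixed (x := x) hs
    rw [← sub_eq_zero, h]
    field_simp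
    ring

/-- Three points of the quadric are independent over the fixed field of `φ²`, in the embedding
`x ↦ (x, φ x)`. -/
lemma quadric_cap (h4 : ∀ x, φ (φ (φ (φ x))) = x) {u v c d : K} (hu : OnQuadric φ u)
    (hv : OnQuadric φ v) (hu1 : φ u ≠ u) (hv1 : φ v ≠ v) (huv : φ u * v ≠ φ v * u)
    (hc : φ (φ c) = c) (hd : φ (φ d) = d) (h1 : c * u + d * v = 1)
    (h2 : c * φ u + d * φ v = 1) : False := by
  -- Applying `φ` to `h1` and `φ³` to `h2` shows that `(φ c, φ d)` solves the same system as `(c,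
  -- d)`. Its determinant is nonzero by `huv`, so `c` and `d` are fixed by `φ`.
  have e1 : φ c * φ u + φ d * φ v = 1 := by rw [← map_mul, ← map_mul, ← map_add, h1, map_one]
  have e2 : φ c * u + φ d * v = 1 := by
    have := congrArg (fun x => φ (φ (φ x))) h2
    simpa [h4, hc, hd] using this
  have hcf : φ c = c := by
    have : (φ c - c) * (φ u * v - φ v * u) = 0 := by
      linear_combination v * e1 - v * h2 - φ v * e2 + φ v * h1
    exact sub_eq_zero.1 ((mul_eq_zero.1 this).resolve_right (sub_ne_zero.2 huv))
  have hdf : φ d = d := by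
    have : (φ d - d) * v = 0 := by linear_combination e2 - h1 - u * hcf
    exact sub_eq_zero.1 ((mul_eq_zero.1 this).resolve_right hv.1)
  have hc0 : c ≠ 0 := by
    rintro rfl
    refine hv1 (mul_left_cancel₀ (a := d) ?_ (by linear_combination h2 - h1))
    rintro rfl
    simp at h1
  have hd0 : d ≠ 0 := by
    rintro rfl
    exact hu1 (mul_left_cancel₀ hc0 (by linear_combination h2 - h1))
  -- Now `-c u` and `-c u + 1 = d v` are two further quadric points on one line through `1`.
  have hx : OnQuadric φ (-c * u) :=
    (OnQuadric.of_fixed (by rw [map_neg, hcf]) (neg_ne_zero.2 hc0)).mul hu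
  have hx1 : OnQuadric φ (-c * u + 1) := by
    rw [show -c * u + 1 = d * v by linear_combination -h1]
    exact (OnQuadric.of_fixed hdf hd0).mul hv
  refine one_ne_zero (hx.eq_zero_of_add hx1 (map_one φ) fun h => hu1 ?_)
  rw [map_mul, map_neg, hcf] at h
  exact mul_left_cancel₀ (neg_ne_zero.2 hc0) h

end Quadric

/-! ### Counting quadric vectors in subspaces through the point `1`. -/

section QuadricCount

variable {K : Type*} [Field K] (φ : K →+* K)

/-- The fixed field of `φ`. -/
abbrev fixedField : Subfield K := φ.eqLocusField (RingHom.id K)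

lemma mem_fixedField {s : K} : s ∈ fixedField φ ↔ φ s = s := Iff.rfl

/-- A ring endomorphism is linear over its fixed field. -/
def fixedLinear : K →ₗ[fixedField φ] K where
  toFun := φ
  map_add' := map_add φ
  map_smul' s x := by
    simp only [Subfield.smul_def, smul_eq_mul, map_mul, RingHom.id_apply]
    rw [(mem_fixedField φ).1 s.2]

/-- The linear form whose kernel is the tangent plane of the quadric at `1`. -/
def tangentForm : K →ₗ[fixedField φ] K :=
  (fixedLinear φ - LinearMap.id) ∘ₗ (LinearMap.id + fixedLinear φ ∘ₗ fixedLinear φ)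

lemma tangentForm_apply (x : K) : tangentForm φ x = φ (quadTrace φ x) - quadTrace φ x := rfl

variable {φ}

/-- The tangent form takes values in the elements negated by `φ`, so dividing by its value at `x₀`
gives a `φ`-fixed scalar and each vector is uniquely a tangent vector plus a fixed multiple of `x₀`.
-/
lemma ncard_tangent_mul (h4 : ∀ x, φ (φ (φ (φ x))) = x) [Finite K]
    (V : Submodule (fixedField φ) K) {x₀ : K} (hx₀ : x₀ ∈ V) (h0 : tangentForm φ x₀ ≠ 0) :
    {z | z ∈ V ∧ tangentForm φ z = 0}.ncard * Nat.card (fixedField φ) = (V : Set K).ncard := by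
  rw [← Nat.card_coe_set_eq, ← Nat.card_coe_set_eq, ← Nat.card_prod]
  refine Nat.card_congr (Equiv.ofBijective
    (fun zs => ⟨zs.1.1 + zs.2 • x₀, V.add_mem zs.1.2.1 (V.smul_mem _ hx₀)⟩) ⟨?_, ?_⟩)
  · rintro ⟨⟨z, hz, hzt⟩, s⟩ ⟨⟨w, hw, hwt⟩, t⟩ h
    have h' : z + s • x₀ = w + t • x₀ := Subtype.mk.inj h
    have hst := congrArg (tangentForm φ) h'
    rw [map_add, map_add, map_smul, map_smul, hzt, hwt, zero_add, zero_add] at hst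
    obtain rfl : s = t := Subtype.ext (mul_right_cancel₀ h0 hst)
    obtain rfl : z = w := add_right_cancel h'
    rfl
  · rintro ⟨x, hx⟩
    have hs : φ (tangentForm φ x / tangentForm φ x₀) = tangentForm φ x / tangentForm φ x₀ := by
      simp only [tangentForm_apply]
      rw [map_div₀, quad_antifixed_trace h4, quad_antifixed_trace h4, neg_div_neg_eq]
    refine ⟨(⟨x - (⟨_, hs⟩ : fixedField φ) • x₀, V.sub_mem hx (V.smul_mem _ hx₀), ?_⟩,
      ⟨_, hs⟩), ?_⟩
    · rw [map_sub, map_smul, Subfield.smul_def, smul_eq_mul, div_mul_cancel₀ _ h0, sub_self]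
    · simp

/-- The number of vectors of a subspace through `1` that lie on the quadric but not on its tangent
plane at `1`. -/
lemma ncard_nontangent_mul (h4 : ∀ x, φ (φ (φ (φ x))) = x) [Finite K]
    (V : Submodule (fixedField φ) K) (h1 : (1 : K) ∈ V) :
    {z | z ∈ V ∧ OnQuadric φ z ∧ tangentForm φ z ≠ 0}.ncard * Nat.card (fixedField φ) =
      {z | z ∈ V ∧ tangentForm φ z ≠ 0}.ncard := by
  have hk : ∀ {s : K}, φ s = s → s ∈ V := fun {s} hs => by
    have := V.smul_mem (⟨s, hs⟩ : fixedField φ) h1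
    rwa [Subfield.smul_def, smul_eq_mul, mul_one] at this
  have hT : ∀ {x s : K}, φ s = s → tangentForm φ (x + s) = tangentForm φ x :=
    fun hs => quadTrace_add_fixed hs
  rw [← Nat.card_coe_set_eq, ← Nat.card_coe_set_eq, ← Nat.card_prod]
  -- Each coset of the fixed field off the tangent plane contains exactly one quadric vector.
  refine Nat.card_congr (Equiv.ofBijective
    (fun zs => ⟨zs.1.1 + zs.2.1, V.add_mem zs.1.2.1 (hk zs.2.2), ?_⟩) ⟨?_, ?_⟩)
  · rw [hT zs.2.2]; exact zs.1.2.2.2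
  · rintro ⟨⟨z, hz, hzq, hzt⟩, s, hs⟩ ⟨⟨w, hw, hwq, hwt⟩, t, ht⟩ h
    have h' : z + s = w + t := Subtype.mk.inj h
    have hst : φ (s - t) = s - t := by
      rw [map_sub, (mem_fixedField φ).1 hs, (mem_fixedField φ).1 ht]
    have hwz : w = z + (s - t) := by linear_combination -h'
    have h0 : s - t = 0 := by
      refine hzq.eq_zero_of_add (hwz ▸ hwq) hst fun hf => hzt ?_
      rw [tangentForm_apply, quadTrace_apply, map_add, hf, hf, hf, sub_self]
    rw [h0, add_zero] at hwz
    subst hwz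
    rw [sub_eq_zero] at h0
    subst h0
    rfl
  · rintro ⟨x, hx, hxt⟩
    obtain ⟨s, hs, hq⟩ := exists_onQuadric_add h4 (sub_ne_zero.1 hxt)
    refine ⟨(⟨x + s, V.add_mem hx (hk hs), hq, by rw [hT hs]; exact hxt⟩,
      ⟨-s, by rw [mem_fixedField, map_neg, hs]⟩), ?_⟩
    simp

/-- The number of vectors on the quadric in a line or plane through the point `1`. -/
lemma ncard_quadric_inter (h4 : ∀ x, φ (φ (φ (φ x))) = x) [Finite K] {q : ℕ} (hq : 1 < q)
    (hk : Nat.card (fixedField φ) = q) (V : Submodule (fixedField φ) K) (h1 : (1 : K) ∈ V)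
    (hV : (V : Set K).ncard = q ^ 2 ∨ (V : Set K).ncard = q ^ 3) :
    ∃ j, (j = 1 ∨ j = 2 ∨ j = q + 1) ∧ {z | z ∈ V ∧ OnQuadric φ z}.ncard = j * (q - 1) := by
  have hkV : ∀ {s : K}, φ s = s → s ∈ V := fun {s} hs => by
    have := V.smul_mem (⟨s, hs⟩ : fixedField φ) h1
    rwa [Subfield.smul_def, smul_eq_mul, mul_one] at this
  have hfixed : {z | z ∈ V ∧ OnQuadric φ z ∧ tangentForm φ z = 0} =
      (fixedField φ : Set K) \ {0} := by
    ext z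
    constructor
    · rintro ⟨-, hz, ht⟩
      exact ⟨hz.fixed_of_tangent (sub_eq_zero.1 ht), hz.1⟩
    · rintro ⟨hz, h0⟩
      have hz' : φ z = z := hz
      refine ⟨hkV hz, OnQuadric.of_fixed hz h0, ?_⟩
      rw [tangentForm_apply, quadTrace_apply, map_add, hz', hz', hz', sub_self]
  have hfc : {z | z ∈ V ∧ OnQuadric φ z ∧ tangentForm φ z = 0}.ncard = q - 1 := by
    rw [hfixed, Set.ncard_sdiff_singleton_of_mem (fixedField φ).zero_mem, ← hk]
    rfl
  have hsplit : {z | z ∈ V ∧ OnQuadric φ z}.ncard = (q - 1) +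
      {z | z ∈ V ∧ OnQuadric φ z ∧ tangentForm φ z ≠ 0}.ncard := by
    rw [← hfc, ← Set.ncard_union_eq]
    · congr 1
      ext z
      simp only [Set.mem_union, Set.mem_ofPred_eq]
      tauto
    · rw [Set.disjoint_left]
      rintro z ⟨-, -, h⟩ ⟨-, -, h'⟩
      exact h' h
  rw [hsplit]
  by_cases hT : ∀ x ∈ V, tangentForm φ x = 0
  · refine ⟨1, Or.inl rfl, ?_⟩
    rw [show {z | z ∈ V ∧ OnQuadric φ z ∧ tangentForm φ z ≠ 0} = ∅ from ?_]
    · simp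
    · ext z
      simp only [Set.mem_ofPred_eq, Set.mem_empty_iff_false, iff_false]
      exact fun h => h.2.2 (hT z h.1)
  · push Not at hT
    obtain ⟨x₀, hx₀, hne⟩ := hT
    have htan := ncard_tangent_mul h4 V hx₀ hne
    have hmul := ncard_nontangent_mul h4 V h1
    have hVsplit : {z | z ∈ V ∧ tangentForm φ z ≠ 0}.ncard +
        {z | z ∈ V ∧ tangentForm φ z = 0}.ncard = (V : Set K).ncard := by
      rw [← Set.ncard_union_eq]
      · congr 1
        ext z
        simp only [Set.mem_union, Set.mem_ofPred_eq, SetLike.mem_coe]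
        tauto
      · rw [Set.disjoint_left]
        rintro z ⟨-, h⟩ ⟨-, h'⟩
        exact h h'
    -- With `A` nontangent quadric vectors and `B` tangent vectors, `A q + B = |V|` and `B q = |V|`;
    -- hence `A = q - 1` or `A = q (q - 1)`.
    rw [← hmul, hk] at hVsplit
    rw [hk] at htan
    generalize {z | z ∈ V ∧ OnQuadric φ z ∧ tangentForm φ z ≠ 0}.ncard = A at hVsplit ⊢
    generalize {z | z ∈ V ∧ tangentForm φ z = 0}.ncard = B at hVsplit htan
    obtain ⟨m, rfl⟩ : ∃ m, q = m + 1 := ⟨q - 1, by omega⟩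
    rw [Nat.add_sub_cancel]
    rcases hV with h | h <;> rw [h] at hVsplit htan
    · refine ⟨2, Or.inr (Or.inl rfl), ?_⟩
      have hB : B = m + 1 := Nat.eq_of_mul_eq_mul_right m.succ_pos (htan.trans (sq _))
      have hA : A * (m + 1) = m * (m + 1) := by rw [hB] at hVsplit; linarith
      rw [Nat.eq_of_mul_eq_mul_right m.succ_pos hA]; ring
    · refine ⟨m + 1 + 1, Or.inr (Or.inr rfl), ?_⟩
      have hB : B = (m + 1) ^ 2 := Nat.eq_of_mul_eq_mul_right m.succ_pos (htan.trans (pow_succ _ _))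
      have hA : A * (m + 1) = (m * (m + 1)) * (m + 1) := by rw [hB] at hVsplit; linarith
      rw [Nat.eq_of_mul_eq_mul_right m.succ_pos hA]; ring

end QuadricCount

/-! ### The quadric over finite fields: its points and plane sections. -/

section FiniteQuadric

lemma exists_isPrimitiveRoot_card_sub_one (K : Type*) [Field K] [Finite K] :
    ∃ g : K, IsPrimitiveRoot g (Nat.card K - 1) := by
  obtain ⟨g, hg⟩ := IsCyclic.exists_generator (α := Kˣ)
  refine ⟨g, ?_⟩
  rw [IsPrimitiveRoot.coe_units_iff, ← Nat.card_units, ← orderOf_eq_card_of_forall_mem_zpowers hg]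
  exact IsPrimitiveRoot.orderOf g

lemma ncard_pow_eq_one {K : Type*} [Field K] [Finite K] {N : ℕ} (hN : N ∣ Nat.card K - 1) :
    {x : K | x ^ N = 1}.ncard = N := by
  have hpos : 0 < Nat.card K - 1 := Nat.sub_pos_of_lt Finite.one_lt_card
  obtain ⟨g, hprim⟩ := exists_isPrimitiveRoot_card_sub_one K
  obtain ⟨M, hM⟩ := hN
  have hN0 : 0 < N := Nat.pos_of_mul_pos_right (hM ▸ hpos)
  have h := (hprim.pow hpos (hM.trans (mul_comm _ _))).card_nthRootsFinset
  rw [← Set.ncard_coe_finset] at h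
  refine Eq.trans ?_ h
  congr 1
  ext x
  simp [mem_nthRootsFinset hN0]

lemma ncard_pow_eq_self {K : Type*} [Field K] [Finite K] {Q : ℕ} (hQ : 1 < Q)
    (hdvd : Q - 1 ∣ Nat.card K - 1) : {x : K | x ^ Q = x}.ncard = Q := by
  have h : {x : K | x ^ Q = x} = insert 0 {x : K | x ^ (Q - 1) = 1} := by
    ext x
    simp only [Set.mem_ofPred_eq, Set.mem_insert_iff]
    obtain ⟨m, rfl⟩ : ∃ m, Q = m + 1 := ⟨Q - 1, by omega⟩
    by_cases hx : x = 0
    · simp [hx]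
    · rw [pow_succ, Nat.add_sub_cancel, mul_eq_right₀ hx]
      simp [hx]
  rw [h, Set.ncard_insert_of_notMem, ncard_pow_eq_one hdvd]
  · omega
  · simp only [Set.mem_ofPred_eq]
    rw [zero_pow (by omega)]
    exact zero_ne_one

lemma sub_one_dvd_card_sub_one {K : Type*} {q : ℕ} (hK : Nat.card K = q ^ 4) : q - 1 ∣ Nat.card K - 1 := by
  rw [hK]; simpa using Nat.sub_dvd_pow_sub_pow q 1 4

lemma sq_sub_one_dvd_card_sub_one {K : Type*} {q : ℕ} (hK : Nat.card K = q ^ 4) : q ^ 2 - 1 ∣ Nat.card K - 1 := by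
  rw [hK, show q ^ 4 = (q ^ 2) ^ 2 by ring]; simpa using Nat.sub_dvd_pow_sub_pow (q ^ 2) 1 2

variable {K : Type*} [Field K] {φ : K →+* K} {q : ℕ}

lemma map_map_eq_pow (hφ : ∀ x, φ x = x ^ q) (x : K) : φ (φ x) = x ^ q ^ 2 := by
  rw [hφ, hφ, ← pow_mul, sq]

lemma onQuadric_iff_pow (hq : 1 < q) (hφ : ∀ x, φ x = x ^ q) (z : K) :
    OnQuadric φ z ↔ z ^ ((q ^ 2 + 1) * (q - 1)) = 1 := by
  have hn : quadNorm φ z = z ^ (q ^ 2 + 1) := by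
    rw [quadNorm_apply, map_map_eq_pow hφ, pow_succ _ (q ^ 2), mul_comm]
  rw [OnQuadric, hφ, hn]
  by_cases hz : z = 0
  · subst hz
    rw [zero_pow (Nat.mul_pos (by positivity) (by omega)).ne']
    simp
  · obtain ⟨m, rfl⟩ : ∃ m, q = m + 1 := ⟨q - 1, by omega⟩
    rw [Nat.add_sub_cancel, pow_mul, pow_succ _ m, mul_eq_right₀ (pow_ne_zero _ hz)]
    simp [hz]

variable (φ) in
/-- The linear map cutting out a plane section of the quadric. -/
def sectionForm (a b : K) : K →ₗ[fixedField φ] K :=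
  (LinearMap.id + fixedLinear φ ∘ₗ fixedLinear φ) ∘ₗ
    (LinearMap.mulLeft (fixedField φ) a + LinearMap.mulLeft (fixedField φ) b ∘ₗ fixedLinear φ)

lemma sectionForm_apply (a b z : K) : sectionForm φ a b z = quadTrace φ (a * z + b * φ z) := rfl

/-- Proportionality over the fixed field would make `ζ^(j-i)` fixed, although `0 < j - i < q² + 1`.
-/
lemma fixed_mul_ne {ζ : K} (hζ : ζ ≠ 0) (hinj : ∀ d : ℕ, φ (ζ ^ d) = ζ ^ d → q ^ 2 + 1 ∣ d)
    {i j : Fin (q ^ 2 + 1)} (hij : i ≠ j) :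
    φ (ζ ^ (i : ℕ)) * ζ ^ (j : ℕ) ≠ φ (ζ ^ (j : ℕ)) * ζ ^ (i : ℕ) := by
  intro h
  wlog hle : (i : ℕ) ≤ j generalizing i j
  · exact this hij.symm h.symm (by omega)
  obtain ⟨d, hd⟩ := Nat.exists_eq_add_of_le hle
  have hne : φ (ζ ^ (i : ℕ)) * ζ ^ (i : ℕ) ≠ 0 :=
    mul_ne_zero ((map_ne_zero φ).2 (pow_ne_zero _ hζ)) (pow_ne_zero _ hζ)
  have hfix : φ (ζ ^ d) = ζ ^ d := by
    apply mul_left_cancel₀ hne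
    rw [hd, pow_add, map_mul] at h
    linear_combination -h
  have hdvd := hinj d hfix
  have hd0 : d = 0 := Nat.eq_zero_of_dvd_of_lt hdvd (by omega)
  exact hij (Fin.ext (by omega))

variable [Finite K]

lemma map_four (hK : Nat.card K = q ^ 4) (hφ : ∀ x, φ x = x ^ q) (x : K) :
    φ (φ (φ (φ x))) = x := by
  have := Fintype.ofFinite K
  rw [map_map_eq_pow hφ, map_map_eq_pow hφ, ← pow_mul, ← pow_add, ← hK,
    Nat.card_eq_fintype_card, FiniteField.pow_card]

lemma card_fixedField (hq : 1 < q) (hK : Nat.card K = q ^ 4) (hφ : ∀ x, φ x = x ^ q) :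
    Nat.card (fixedField φ) = q := by
  rw [← ncard_pow_eq_self hq (sub_one_dvd_card_sub_one hK)]
  change (fixedField φ : Set K).ncard = _
  congr 1
  ext x
  exact (mem_fixedField φ).trans (by rw [hφ]; rfl)

lemma ncard_fixed_sq (hq : 1 < q) (hK : Nat.card K = q ^ 4) (hφ : ∀ x, φ x = x ^ q) :
    {x | φ (φ x) = x}.ncard = q ^ 2 := by
  simp only [map_map_eq_pow hφ]
  exact ncard_pow_eq_self (Nat.one_lt_pow two_ne_zero hq) (sq_sub_one_dvd_card_sub_one hK)

lemma ncard_onQuadric (hq : 1 < q) (hK : Nat.card K = q ^ 4) (hφ : ∀ x, φ x = x ^ q) :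
    {z | OnQuadric φ z}.ncard = (q ^ 2 + 1) * (q - 1) := by
  simp only [onQuadric_iff_pow hq hφ]
  refine ncard_pow_eq_one ⟨q + 1, ?_⟩
  rw [hK]
  obtain ⟨m, rfl⟩ : ∃ m, q = m + 1 := ⟨q - 1, by omega⟩
  rw [Nat.add_sub_cancel]
  apply Nat.sub_eq_of_eq_add
  ring

lemma exists_not_fixed (hq : 1 < q) (hK : Nat.card K = q ^ 4) (hφ : ∀ x, φ x = x ^ q) :
    ∃ e, φ (φ e) = e ∧ φ e ≠ e := by
  by_contra! h
  have h1 := Set.ncard_le_ncard (s := {x | φ (φ x) = x}) (t := (fixedField φ : Set K)) h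
  rw [ncard_fixed_sq hq hK hφ] at h1
  have h2 : (fixedField φ : Set K).ncard = q := card_fixedField hq hK hφ
  nlinarith

/-- A vanishing trace would give characteristic two at `x = 1`, and then `φ²` would be the identity,
but it fixes only `q²` elements. -/
lemma exists_quadTrace_ne_zero (hq : 1 < q) (hK : Nat.card K = q ^ 4) (hφ : ∀ x, φ x = x ^ q) :
    ∃ w, quadTrace φ w ≠ 0 := by
  by_contra! h
  have h1 : (1 : K) + 1 = 0 := by simpa [quadTrace_apply] using h 1
  have h2 : {x | φ (φ x) = x} = Set.univ := by
    ext x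
    have hx := h x
    rw [quadTrace_apply] at hx
    simp only [Set.mem_ofPred_eq, Set.mem_univ, iff_true]
    linear_combination hx - x * h1
  have h3 := ncard_fixed_sq hq hK hφ
  rw [h2, Set.ncard_univ, hK] at h3
  exact absurd (Nat.pow_right_injective hq h3) (by norm_num)

lemma sectionForm_ne_zero (hq : 1 < q) (hK : Nat.card K = q ^ 4) (hφ : ∀ x, φ x = x ^ q)
    {a b : K} (hab : a ≠ 0 ∨ b ≠ 0) : sectionForm φ a b ≠ 0 := by
  intro h0
  have h : ∀ z, quadTrace φ (a * z + b * φ z) = 0 := fun z => LinearMap.congr_fun h0 z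
  obtain ⟨e, he, hne⟩ := exists_not_fixed hq hK hφ
  obtain ⟨w, hw⟩ := exists_quadTrace_ne_zero hq hK hφ
  -- Replacing `z` by `e z` multiplies the first trace by `e` and the second by `φ e ≠ e`, which
  -- separates them.
  have hsplit : ∀ z, quadTrace φ (a * z) = 0 ∧ quadTrace φ (b * φ z) = 0 := by
    intro z
    have h1 := h z
    have h2 := h (e * z)
    simp only [quadTrace_apply, map_add, map_mul, he] at h1 h2 ⊢
    have h3 : (φ e - e) * (b * φ z + φ (φ b) * φ (φ (φ z))) = 0 := by
      linear_combination h2 - e * h1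
    have h4 := (mul_eq_zero.1 h3).resolve_left (sub_ne_zero.2 hne)
    exact ⟨by linear_combination h1 - h4, h4⟩
  rcases hab with ha | hb
  · have := (hsplit (a⁻¹ * w)).1
    rw [mul_inv_cancel_left₀ ha] at this
    exact hw this
  · have := (hsplit (φ (φ (φ (b⁻¹ * w))))).2
    rw [map_four hK hφ, mul_inv_cancel_left₀ hb] at this
    exact hw this

/-- The form is nonzero with values in the field of `q²` elements, so its rank over the field of `q`
elements is one or two. -/
lemma ncard_ker_sectionForm (hq : 1 < q) (hK : Nat.card K = q ^ 4) (hφ : ∀ x, φ x = x ^ q)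
    {a b : K} (hab : a ≠ 0 ∨ b ≠ 0) :
    ((sectionForm φ a b).ker : Set K).ncard = q ^ 2 ∨
      ((sectionForm φ a b).ker : Set K).ncard = q ^ 3 := by
  have hk := card_fixedField hq hK hφ
  have hdim : Module.finrank (fixedField φ) K = 4 := by
    have h := Module.natCard_eq_pow_finrank (K := fixedField φ) (V := K)
    rw [hk, hK] at h
    exact (Nat.pow_right_injective hq h).symm
  have hsum := LinearMap.finrank_range_add_finrank_ker (sectionForm φ a b)
  rw [hdim] at hsum
  have hrange : Module.finrank (fixedField φ) (sectionForm φ a b).range ≤ 2 := by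
    have h := Module.natCard_eq_pow_finrank (K := fixedField φ) (V := (sectionForm φ a b).range)
    rw [hk] at h
    rw [← Nat.pow_le_pow_iff_right hq, ← h, ← ncard_fixed_sq hq hK hφ]
    change ((sectionForm φ a b).range : Set K).ncard ≤ _
    refine Set.ncard_le_ncard ?_
    rintro _ ⟨z, rfl⟩
    simp only [sectionForm_apply, quadTrace_apply, Set.mem_ofPred_eq]
    rw [map_add, map_add, map_four hK hφ, add_comm]
  have hpos : 0 < Module.finrank (fixedField φ) (sectionForm φ a b).range := by
    rw [Nat.pos_iff_ne_zero]
    intro h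
    rw [Submodule.finrank_eq_zero, LinearMap.range_eq_bot] at h
    exact sectionForm_ne_zero hq hK hφ hab h
  have hV := Module.natCard_eq_pow_finrank (K := fixedField φ) (V := (sectionForm φ a b).ker)
  rw [hk] at hV
  change ((sectionForm φ a b).ker : Set K).ncard = _ at hV
  rw [hV]
  have : Module.finrank (fixedField φ) (sectionForm φ a b).ker = 2 ∨
    Module.finrank (fixedField φ) (sectionForm φ a b).ker = 3 := by omega
  rcases this with h | h
  · left; rw [h]
  · right; rw [h]

/-- Plane sections, over the fixed field of `φ²`, of the quadric. -/
lemma ncard_onQuadric_section (hq : 1 < q) (hK : Nat.card K = q ^ 4) (hφ : ∀ x, φ x = x ^ q)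
    {a b : K} (hab : a ≠ 0 ∨ b ≠ 0) :
    ∃ j, (j = 0 ∨ j = 1 ∨ j = 2 ∨ j = q + 1) ∧
      {z | OnQuadric φ z ∧ sectionForm φ a b z = 0}.ncard = j * (q - 1) := by
  by_cases hex : ∃ z₀, OnQuadric φ z₀ ∧ sectionForm φ a b z₀ = 0
  · obtain ⟨z₀, hz₀, h0⟩ := hex
    have hne : φ z₀ ≠ 0 := (map_ne_zero φ).2 hz₀.1
    -- The substitution `z = z₀ w` moves the point `z₀` of the section to `1`.
    have hmul : ∀ w, sectionForm φ (a * z₀) (b * φ z₀) w = sectionForm φ a b (z₀ * w) := by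
      intro w
      simp only [sectionForm_apply, map_mul]
      congr 1
      ring
    obtain ⟨j, hj, hcard⟩ := ncard_quadric_inter (map_four hK hφ) hq (card_fixedField hq hK hφ)
      (sectionForm φ (a * z₀) (b * φ z₀)).ker
      (by rw [LinearMap.mem_ker, hmul, mul_one, h0])
      (ncard_ker_sectionForm hq hK hφ
        (hab.imp (fun h => mul_ne_zero h hz₀.1) fun h => mul_ne_zero h hne))
    refine ⟨j, Or.inr hj, ?_⟩
    rw [← hcard]
    refine Eq.trans ?_ (Set.ncard_image_of_injective _ (mul_right_injective₀ hz₀.1))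
    congr 1
    ext z
    simp only [Set.mem_ofPred_eq, Set.mem_image, LinearMap.mem_ker, hmul]
    constructor
    · rintro ⟨hz, h⟩
      refine ⟨z₀⁻¹ * z, ⟨?_, hz₀.inv.mul hz⟩, mul_inv_cancel_left₀ hz₀.1 z⟩
      rwa [mul_inv_cancel_left₀ hz₀.1]
    · rintro ⟨w, ⟨h, hw⟩, rfl⟩
      exact ⟨hz₀.mul hw, h⟩
  · refine ⟨0, Or.inl rfl, ?_⟩
    rw [zero_mul, Set.ncard_eq_zero]
    ext z
    simp only [Set.mem_ofPred_eq, Set.mem_empty_iff_false, iff_false]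
    exact fun h => hex ⟨z, h⟩

/-- If the powers of `ζ` below `q² + 1` represent distinct points of the quadric, then they
represent all points. -/
lemma ncard_onQuadric_of_pow (hq : 1 < q) (hK : Nat.card K = q ^ 4) (hφ : ∀ x, φ x = x ^ q)
    {ζ : K} (hζ : OnQuadric φ ζ) (hinj : ∀ d : ℕ, φ (ζ ^ d) = ζ ^ d → q ^ 2 + 1 ∣ d)
    (P : K → Prop) (hP : ∀ s z, φ s = s → s ≠ 0 → (P (s * z) ↔ P z)) :
    {z | OnQuadric φ z ∧ P z}.ncard =
      {i : Fin (q ^ 2 + 1) | P (ζ ^ (i : ℕ))}.ncard * (q - 1) := by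
  set f : Fin (q ^ 2 + 1) × K → K := fun is => is.2 * ζ ^ (is.1 : ℕ) with hf
  set k : Set K := (fixedField φ : Set K) \ {0} with hk
  have hkc : k.ncard = q - 1 := by
    rw [hk, Set.ncard_sdiff_singleton_of_mem (fixedField φ).zero_mem]
    change Nat.card (fixedField φ) - 1 = _
    rw [card_fixedField hq hK hφ]
  have hfinj : Set.InjOn f (Set.univ ×ˢ k) := by
    rintro ⟨i, s⟩ ⟨-, hs, hs0⟩ ⟨j, t⟩ ⟨-, ht, ht0⟩ h
    have hs : φ s = s := hs
    have ht : φ t = t := ht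
    have h : s * ζ ^ (i : ℕ) = t * ζ ^ (j : ℕ) := h
    have h' := congrArg φ h
    rw [map_mul, map_mul, hs, ht] at h'
    have hij : i = j := by
      by_contra hij
      refine fixed_mul_ne hζ.1 hinj hij (mul_left_cancel₀ hs0 (mul_left_cancel₀ ht0 ?_))
      linear_combination t * ζ ^ (j : ℕ) * h' - φ (ζ ^ (j : ℕ)) * t * h
    subst hij
    rw [mul_right_cancel₀ (pow_ne_zero _ hζ.1) h]
  have hsub : f '' (Set.univ ×ˢ k) ⊆ {z | OnQuadric φ z} := by
    rintro _ ⟨⟨i, s⟩, ⟨-, hs, hs0⟩, rfl⟩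
    exact (OnQuadric.of_fixed hs hs0).mul (hζ.pow i)
  -- The scaled powers number `(q² + 1)(q - 1)`, which is the size of the whole quadric.
  have himage : f '' (Set.univ ×ˢ k) = {z | OnQuadric φ z} := by
    refine Set.eq_of_subset_of_ncard_le hsub ?_
    rw [hfinj.ncard_image, Set.ncard_prod, hkc, ncard_onQuadric hq hK hφ,
      Set.ncard_univ, Nat.card_eq_fintype_card, Fintype.card_fin]
  rw [← hkc, ← Set.ncard_prod, ←
    (hfinj.mono (Set.prod_mono (Set.subset_univ _) subset_rfl)).ncard_image]
  congr 1
  ext z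
  constructor
  · rintro ⟨hz, hPz⟩
    obtain ⟨⟨i, s⟩, ⟨-, hs⟩, rfl⟩ := himage.symm.subset hz
    exact ⟨(i, s), ⟨(hP s _ hs.1 hs.2).1 hPz, hs⟩, rfl⟩
  · rintro ⟨⟨i, s⟩, ⟨hi, hs⟩, rfl⟩
    exact ⟨hsub ⟨(i, s), ⟨Set.mem_univ _, hs⟩, rfl⟩, (hP s _ hs.1 hs.2).2 hi⟩

/-- The number of points, among the first `q² + 1` powers of `ζ`, on a plane. -/
lemma ncard_sectionForm_pow_eq_zero (hq : 1 < q) (hK : Nat.card K = q ^ 4)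
    (hφ : ∀ x, φ x = x ^ q) {ζ : K} (hζ : OnQuadric φ ζ)
    (hinj : ∀ d : ℕ, φ (ζ ^ d) = ζ ^ d → q ^ 2 + 1 ∣ d) {a b : K} (hab : a ≠ 0 ∨ b ≠ 0) :
    {i : Fin (q ^ 2 + 1) | sectionForm φ a b (ζ ^ (i : ℕ)) = 0}.ncard ∈
      ({0, 1, 2, q + 1} : Set ℕ) := by
  obtain ⟨j, hj, hcard⟩ := ncard_onQuadric_section hq hK hφ hab
  rw [ncard_onQuadric_of_pow hq hK hφ hζ hinj (fun z => sectionForm φ a b z = 0)] at hcard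
  · rw [Nat.eq_of_mul_eq_mul_right (by omega) hcard]
    simpa using hj
  · intro s z hs hs0
    have := (sectionForm φ a b).map_smul ⟨s, hs⟩ z
    simp only [Subfield.smul_def, smul_eq_mul] at this
    rw [this, mul_eq_zero, or_iff_right hs0]

end FiniteQuadric

/-! ### Constacyclic codes and check polynomials. -/

section Constacyclic

variable {F : Type*} [Field F] {n : ℕ} {lam : F} {h : F[X]}

/-- The polynomial `∑ cᵢ xⁱ` of a word. -/
noncomputable def wordPoly (c : Fin n → F) : F[X] := ∑ i : Fin n, Polynomial.C (c i) * X ^ (i : ℕ)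

lemma coeff_wordPoly (c : Fin n → F) (i : Fin n) : (wordPoly c).coeff i = c i := by
  rw [wordPoly, finsetSum_coeff, sum_eq_single i]
  · simp
  · intro j _ hj
    rw [coeff_C_mul_X_pow, if_neg fun h => hj (Fin.ext h.symm)]
  · simp

lemma degree_wordPoly_lt (c : Fin n → F) : (wordPoly c).degree < n := by
  refine (degree_sum_le _ _).trans_lt ((Finset.sup_lt_iff (WithBot.bot_lt_coe n)).2 fun i _ => ?_)
  exact (degree_C_mul_X_pow_le _ _).trans_lt (Nat.cast_lt.2 i.2)

lemma toQuotient_apply (c : Fin n → F) :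
    toQuotient n lam c = AdjoinRoot.mk (X ^ n - Polynomial.C lam) (wordPoly c) := by
  simp only [toQuotient, LinearMap.sum_apply, LinearMap.comp_apply, LinearMap.proj_apply,
    LinearMap.toSpanSingleton_apply, wordPoly, map_sum, map_mul, map_pow, AdjoinRoot.mk_X]
  refine sum_congr rfl fun i _ => ?_
  rw [Algebra.smul_def]
  rfl

lemma X_pow_sub_C_ne (hn : 0 < n) (lam : F) : (X ^ n - Polynomial.C lam : F[X]) ≠ 0 :=
  (monic_X_pow_sub_C lam hn.ne').ne_zero

/-- The generator divides the modulus, so divisibility by it may be tested before passing to the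
quotient. -/
lemma mem_codeOfCheck_iff_generator (hn : 0 < n) (hh : h ∣ X ^ n - Polynomial.C lam)
    {c : Fin n → F} :
    c ∈ codeOfCheck n lam h ↔ (X ^ n - Polynomial.C lam) / h ∣ wordPoly c := by
  have hP := X_pow_sub_C_ne hn lam
  have hgh : (X ^ n - Polynomial.C lam) = h * ((X ^ n - Polynomial.C lam) / h) :=
    (EuclideanDomain.mul_div_cancel' (ne_zero_of_dvd_ne_zero hP hh) hh).symm
  rw [codeOfCheck, codeOfGenerator, Submodule.mem_comap, Submodule.restrictScalars_mem,
    toQuotient_apply, Ideal.mem_span_singleton]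
  constructor
  · rintro ⟨u, hu⟩
    obtain ⟨u, rfl⟩ := AdjoinRoot.mk_surjective u
    rw [← map_mul, AdjoinRoot.mk_eq_mk] at hu
    have h1 : (X ^ n - Polynomial.C lam) / h ∣ X ^ n - Polynomial.C lam :=
      ⟨h, by rw [mul_comm]; exact hgh⟩
    exact (dvd_iff_dvd_of_dvd_sub (h1.trans hu)).2 (dvd_mul_right _ _)
  · exact fun hd => map_dvd _ hd

lemma mem_codeOfCheck_iff (hn : 0 < n) (hh : h ∣ X ^ n - Polynomial.C lam) {c : Fin n → F} :
    c ∈ codeOfCheck n lam h ↔ X ^ n - Polynomial.C lam ∣ wordPoly c * h := by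
  have hP := X_pow_sub_C_ne hn lam
  have hh0 := ne_zero_of_dvd_ne_zero hP hh
  rw [mem_codeOfCheck_iff_generator hn hh, ← mul_dvd_mul_iff_right hh0,
    mul_comm (_ / _) h, EuclideanDomain.mul_div_cancel' hh0 hh]

/-- A word is the generator times a polynomial of degree below that of `h`. The upper bound
suffices, since trace words supply the lower one. -/
lemma finrank_codeOfCheck_le (hn : 0 < n) (hh : h ∣ X ^ n - Polynomial.C lam) :
    Module.finrank F (codeOfCheck n lam h) ≤ h.natDegree := by
  have hP := X_pow_sub_C_ne hn lam
  have hh0 := ne_zero_of_dvd_ne_zero hP hh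
  set g := (X ^ n - Polynomial.C lam) / h with hg
  have hgh : g * h = X ^ n - Polynomial.C lam := by
    rw [mul_comm, EuclideanDomain.mul_div_cancel' hh0 hh]
  let L : degreeLT F h.natDegree →ₗ[F] (Fin n → F) :=
    (LinearMap.pi fun i : Fin n => lcoeff F i) ∘ₗ LinearMap.mulLeft F g ∘ₗ
      (degreeLT F h.natDegree).subtype
  have hle : codeOfCheck n lam h ≤ L.range := by
    intro c hc
    obtain ⟨u, hu⟩ := (mem_codeOfCheck_iff_generator hn hh).1 hc
    have hdeg : u.degree < h.natDegree := by
      have h1 := degree_wordPoly_lt c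
      rw [hu, degree_mul] at h1
      have h2 : (g * h).degree = n := by rw [hgh]; exact degree_X_pow_sub_C hn lam
      rw [degree_mul, degree_eq_natDegree hh0] at h2
      rw [← h2, ← hg] at h1
      exact lt_of_add_lt_add_left h1
    refine ⟨⟨u, mem_degreeLT.2 hdeg⟩, ?_⟩
    ext i
    rw [← coeff_wordPoly c i, hu]
    rfl
  calc Module.finrank F (codeOfCheck n lam h) ≤ Module.finrank F L.range :=
        Submodule.finrank_mono hle
    _ ≤ Module.finrank F (degreeLT F h.natDegree) := LinearMap.finrank_range_le L
    _ = h.natDegree := by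
        rw [(degreeLTEquiv F h.natDegree).finrank_eq, Module.finrank_fin_fun]

/-- The constacyclic shift is multiplication by the root of the quotient ring, which preserves
ideals. -/
lemma isConstacyclic_codeOfCheck (lam : F) (h : F[X]) :
    IsConstacyclic lam (codeOfCheck (n + 1) lam h) := by
  intro c hc
  rw [codeOfCheck, codeOfGenerator, Submodule.mem_comap, Submodule.restrictScalars_mem] at hc ⊢
  have hroot : AdjoinRoot.root (X ^ (n + 1) - Polynomial.C lam) ^ (n + 1) =
      algebraMap F (AdjoinRoot (X ^ (n + 1) - Polynomial.C lam)) lam := by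
    have := AdjoinRoot.eval₂_root (X ^ (n + 1) - Polynomial.C lam)
    rw [eval₂_sub, eval₂_X_pow, eval₂_C, sub_eq_zero] at this
    exact this
  have hshift : toQuotient (n + 1) lam
      (Fin.cons (lam * c (Fin.last n)) fun i : Fin n => c i.castSucc) =
      AdjoinRoot.root (X ^ (n + 1) - Polynomial.C lam) * toQuotient (n + 1) lam c := by
    simp only [toQuotient, LinearMap.sum_apply, LinearMap.comp_apply, LinearMap.proj_apply,
      LinearMap.toSpanSingleton_apply, Algebra.smul_def]
    rw [Fin.sum_univ_succ, Fin.sum_univ_castSucc, mul_add, mul_sum]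
    refine (add_comm _ _).trans (congrArg₂ _ ?_ ?_)
    · refine sum_congr rfl fun i _ => ?_
      simp only [Fin.cons_succ, Fin.val_succ, Fin.val_castSucc]
      ring
    · simp only [Fin.cons_zero, Fin.val_zero, pow_zero, mul_one, map_mul, Fin.val_last]
      rw [← hroot]
      ring
  rw [hshift]
  exact Ideal.mul_mem_left _ _ hc

/-- The geometric word is a scalar multiple of `(xⁿ - θⁿ) / (x - θ)`, and `h` supplies the factor `x
- θ`. -/
lemma dvd_geom_word_mul {K : Type*} [Field K] {h : K[X]} {lam θ : K} (hθ : θ ^ n = lam)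
    (h0 : θ ≠ 0) (hroot : h.IsRoot θ) (a : K) :
    X ^ n - Polynomial.C lam ∣ wordPoly (fun i : Fin n => a * (θ⁻¹) ^ (i : ℕ)) * h := by
  obtain ⟨u, rfl⟩ := dvd_iff_isRoot.2 hroot
  rcases Nat.eq_zero_or_pos n with rfl | hn
  · simp [wordPoly]
  have hgeom := (Commute.all (X : K[X]) (Polynomial.C θ)).geom_sum₂_mul n
  have hw : wordPoly (fun i : Fin n => a * (θ⁻¹) ^ (i : ℕ)) =
      Polynomial.C (a * (θ⁻¹) ^ (n - 1)) *
        ∑ i ∈ range n, X ^ i * Polynomial.C θ ^ (n - 1 - i) := by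
    rw [wordPoly, mul_sum, ← Fin.sum_univ_eq_sum_range]
    refine sum_congr rfl fun i _ => ?_
    rw [← map_pow, mul_left_comm, ← map_mul, mul_comm (X ^ _)]
    congr 2
    have hi : n - 1 = i + (n - 1 - i) := by have := i.2; omega
    conv_rhs => rw [hi, pow_add]
    rw [Nat.add_sub_cancel_left, mul_assoc, mul_assoc, ← mul_pow, inv_mul_cancel₀ h0, one_pow,
      mul_one]
  refine ⟨Polynomial.C (a * (θ⁻¹) ^ (n - 1)) * u, ?_⟩
  rw [hw, ← hθ, map_pow, ← hgeom]
  ring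

end Constacyclic

/-! ### Trace description of the code and its link with the quadric. -/

section TraceCode

/-- The words `(Tr(a θ₁⁻ⁱ + b θ₂⁻ⁱ))ᵢ`. -/
noncomputable def traceWord (F : Type*) {K : Type*} [Field F] [Field K] [Algebra F K] (n : ℕ)
    (θ₁ θ₂ : K) : K × K →ₗ[F] (Fin n → F) :=
  LinearMap.pi fun i => Algebra.trace F K ∘ₗ
    (LinearMap.mulRight F (θ₁⁻¹ ^ (i : ℕ)) ∘ₗ LinearMap.fst F K K +
      LinearMap.mulRight F (θ₂⁻¹ ^ (i : ℕ)) ∘ₗ LinearMap.snd F K K)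

lemma traceWord_apply {F K : Type*} [Field F] [Field K] [Algebra F K] {n : ℕ} (θ₁ θ₂ a b : K)
    (i : Fin n) : traceWord F n θ₁ θ₂ (a, b) i =
      Algebra.trace F K (a * θ₁⁻¹ ^ (i : ℕ) + b * θ₂⁻¹ ^ (i : ℕ)) := rfl

lemma minpoly_dvd_X_pow_sub_C {F K : Type*} [Field F] [Field K] [Algebra F K] {n : ℕ} {lam : F}
    {θ : K} (hθ : θ ^ n = algebraMap F K lam) :
    minpoly F θ ∣ X ^ n - Polynomial.C lam :=
  minpoly.dvd F θ (by simp [hθ])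

/-- Three points of the quadric among the powers of `ζ` are independent. -/
lemma eq_zero_of_sum_pow {K : Type*} [Field K] {φ : K →+* K} {q : ℕ} (hq : 2 < q)
    (h4 : ∀ x, φ (φ (φ (φ x))) = x) {ζ : K} (hζ : OnQuadric φ ζ)
    (hinj : ∀ d : ℕ, φ (ζ ^ d) = ζ ^ d → q ^ 2 + 1 ∣ d) {S : Finset (Fin (q ^ 2 + 1))}
    (hS : S.card ≤ 3) {y : Fin (q ^ 2 + 1) → K} (hy : ∀ i, φ (φ (y i)) = y i)
    (hyS : ∀ i ∉ S, y i = 0) (h1 : ∑ i, y i * ζ ^ (i : ℕ) = 0)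
    (h2 : ∑ i, y i * φ (ζ ^ (i : ℕ)) = 0) : y = 0 := by
  by_contra hne
  obtain ⟨i, hi⟩ := Function.ne_iff.1 hne
  rw [Pi.zero_apply] at hi
  -- Padding to exactly three coordinates is harmless: only the coefficient at `i` must be nonzero.
  obtain ⟨T, hST, hT⟩ := exists_superset_card_eq hS
    (show 3 ≤ Fintype.card (Fin (q ^ 2 + 1)) by rw [Fintype.card_fin]; nlinarith)
  have hyT : ∀ i ∉ T, y i = 0 := fun i hi => hyS i fun h => hi (hST h)
  have hiT : i ∈ T := by by_contra h; exact hi (hyT i h)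
  obtain ⟨j, l, hjl, hjlT⟩ := card_eq_two.1
    (show (T.erase i).card = 2 by rw [card_erase_of_mem hiT, hT])
  have hTi : T = {i, j, l} := by rw [← insert_erase hiT, hjlT]
  have hij : i ≠ j := fun h => (mem_erase.1 (hjlT ▸ mem_insert_self j {l})).1 h.symm
  have hil : i ≠ l := fun h =>
    (mem_erase.1 (hjlT ▸ mem_insert_of_mem (mem_singleton_self l))).1 h.symm
  have hsum : ∀ g : Fin (q ^ 2 + 1) → K,
      ∑ m, y m * g m = y i * g i + (y j * g j + y l * g l) := by
    intro g
    rw [← sum_subset (subset_univ T) fun m _ hm => by rw [hyT m hm, zero_mul], hTi,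
      sum_insert (by simp [hij, hil]), sum_insert (by simpa using hjl), sum_singleton]
  rw [hsum] at h1 h2
  have hzi := (hζ.pow (i : ℕ)).1
  have hpi : φ (ζ ^ (i : ℕ)) ≠ 0 := (map_ne_zero φ).2 hzi
  -- Dividing by `-y i * ζ ^ i`, and by its analogue in the second relation, moves the `i`-th point
  -- to `1`.
  refine quadric_cap h4 (u := ζ ^ (j : ℕ) * (ζ ^ (i : ℕ))⁻¹) (v := ζ ^ (l : ℕ) * (ζ ^ (i : ℕ))⁻¹)
    (c := -(y j / y i)) (d := -(y l / y i)) ((hζ.pow _).mul (hζ.pow _).inv)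
    ((hζ.pow _).mul (hζ.pow _).inv) ?_ ?_ ?_ ?_ ?_ ?_ ?_
  · intro h
    refine fixed_mul_ne hζ.1 hinj hij ?_
    rw [map_mul, map_inv₀, ← div_eq_mul_inv, ← div_eq_mul_inv, div_eq_div_iff hpi hzi] at h
    linear_combination -h
  · intro h
    refine fixed_mul_ne hζ.1 hinj hil ?_
    rw [map_mul, map_inv₀, ← div_eq_mul_inv, ← div_eq_mul_inv, div_eq_div_iff hpi hzi] at h
    linear_combination -h
  · intro h
    refine fixed_mul_ne hζ.1 hinj hjl ?_
    rw [map_mul, map_mul, map_inv₀] at h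
    have hne : (φ (ζ ^ (i : ℕ)))⁻¹ * (ζ ^ (i : ℕ))⁻¹ ≠ 0 :=
      mul_ne_zero (inv_ne_zero hpi) (inv_ne_zero hzi)
    apply mul_left_cancel₀ hne
    linear_combination h
  · rw [map_neg, map_neg, map_div₀, map_div₀, hy, hy]
  · rw [map_neg, map_neg, map_div₀, map_div₀, hy, hy]
  · field_simp
    linear_combination -h1
  · rw [map_mul, map_mul, map_inv₀]
    field_simp
    linear_combination -h2

/-- The data relating the constacyclic code to the elliptic quadric: `δ ^ (q² + 1) = lam` with
`lam ^ (q + 1) = 1`, the powers of `δ` are in general position, and `φ` is the `q`-Frobenius. -/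
structure QuadricData {F K : Type*} [Field F] [Fintype F] [Field K] [Finite K] [Algebra F K]
    (q : ℕ) (φ : K →+* K) (lam : F) (δ : K) : Prop where
  two_lt : 2 < q
  card_field : Fintype.card F = q ^ 2
  card_ext : Nat.card K = q ^ 4
  frob : ∀ x, φ x = x ^ q
  lam_pow : lam ^ (q + 1) = 1
  pow_eq : δ ^ (q ^ 2 + 1) = algebraMap F K lam
  general : ∀ d, δ ^ ((q ^ 2 + q) * d) = 1 → q ^ 2 + 1 ∣ d

namespace QuadricData

variable {F K : Type*} [Field F] [Fintype F] [Field K] [Finite K] [Algebra F K]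
  {q : ℕ} {φ : K →+* K} {lam : F} {δ : K}

lemma one_lt (D : QuadricData q φ lam δ) : 1 < q := by have := D.two_lt; omega

lemma lam_ne_zero (D : QuadricData q φ lam δ) : lam ≠ 0 := by
  intro h
  have := D.lam_pow
  rw [h, zero_pow (by omega)] at this
  exact zero_ne_one this

lemma ne_zero (D : QuadricData q φ lam δ) : δ ≠ 0 := by
  rintro rfl
  have := D.pow_eq
  rw [zero_pow (by omega), eq_comm, map_eq_zero] at this
  exact D.lam_ne_zero this

lemma finrank_eq_two (D : QuadricData q φ lam δ) : Module.finrank F K = 2 := by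
  have h := Module.natCard_eq_pow_finrank (K := F) (V := K)
  rw [Nat.card_eq_fintype_card (α := F), D.card_field, D.card_ext, ← pow_mul] at h
  have := Nat.pow_right_injective D.one_lt h
  omega

lemma frob_frob_algebraMap (D : QuadricData q φ lam δ) (x : F) :
    φ (φ (algebraMap F K x)) = algebraMap F K x := by
  rw [map_map_eq_pow D.frob, ← map_pow, ← D.card_field, FiniteField.pow_card]

lemma algebraMap_trace (D : QuadricData q φ lam δ) (x : K) :
    algebraMap F K (Algebra.trace F K x) = quadTrace φ x := by
  rw [FiniteField.algebraMap_trace_eq_sum_pow, D.finrank_eq_two, sum_range_succ, sum_range_one,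
    Nat.card_eq_fintype_card, D.card_field, pow_zero, pow_one, pow_one, quadTrace_apply,
    map_map_eq_pow D.frob]

lemma eq_zero_of_trace_mul (D : QuadricData q φ lam δ) {w : K}
    (h : ∀ a, Algebra.trace F K (a * w) = 0) : w = 0 := by
  by_contra hw
  obtain ⟨v, hv⟩ := exists_quadTrace_ne_zero D.one_lt D.card_ext D.frob
  apply hv
  rw [← D.algebraMap_trace, ← div_mul_cancel₀ v hw, h, map_zero]

/-- A Hilbert 90 type statement for `lam⁻¹`. -/
lemma exists_scaling (D : QuadricData q φ lam δ) :
    ∃ τ : F, τ ≠ 0 ∧ τ ^ q * lam = τ := by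
  obtain ⟨g, hg⟩ := IsCyclic.exists_generator (α := Fˣ)
  obtain ⟨j, hj⟩ := mem_powers_iff_mem_zpowers.2 (hg (Units.mk0 lam D.lam_ne_zero)⁻¹)
  have hq := D.one_lt
  have hord : orderOf g = (q + 1) * (q - 1) := by
    rw [orderOf_eq_card_of_forall_mem_zpowers hg, Nat.card_units, Nat.card_eq_fintype_card,
      D.card_field, ← Nat.sq_sub_sq q 1, one_pow]
  -- As `λ⁻¹ = g^j` has `(q + 1)`-th power one, `q - 1` divides `j`, and `τ = g^(j/(q-1))`.
  have hpow : g ^ (j * (q + 1)) = 1 := by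
    rw [pow_mul, show g ^ j = _ from hj, inv_pow, inv_eq_one]
    ext
    simpa using D.lam_pow
  have hdvd := orderOf_dvd_of_pow_eq_one hpow
  rw [hord, mul_comm j] at hdvd
  obtain ⟨m, rfl⟩ := Nat.dvd_of_mul_dvd_mul_left (by omega) hdvd
  refine ⟨(g ^ m : Fˣ), Units.ne_zero _, ?_⟩
  have h1 : (g ^ m) ^ q * Units.mk0 lam D.lam_ne_zero = g ^ m := by
    have hj' : g ^ ((q - 1) * m) = (Units.mk0 lam D.lam_ne_zero)⁻¹ := hj
    rw [← pow_mul, show m * q = m + (q - 1) * m by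
      obtain ⟨k, rfl⟩ : ∃ k, q = k + 1 := ⟨q - 1, by omega⟩
      rw [Nat.add_sub_cancel]; ring, pow_add, hj', inv_mul_cancel_right]
  simpa using congrArg Units.val h1

variable {τ : F}

/-- Here `φ τ = τ / λ` and `λ = δ^(q²+1)`; this is what singles out the exponent `q² + q + 1`. -/
lemma frob_point (D : QuadricData q φ lam δ) (hτ : τ ^ q * lam = τ) :
    φ (algebraMap F K τ * δ⁻¹) = algebraMap F K τ * (δ ^ (q ^ 2 + q + 1))⁻¹ := by
  have h1 : φ (algebraMap F K τ) * algebraMap F K lam = algebraMap F K τ := by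
    rw [D.frob, ← map_pow, ← map_mul, hτ]
  have hδ := D.ne_zero
  rw [map_mul, map_inv₀, D.frob δ, show q ^ 2 + q + 1 = (q ^ 2 + 1) + q by ring, pow_add, mul_inv,
    D.pow_eq, ← mul_assoc]
  congr 1
  rw [← div_eq_mul_inv, eq_div_iff ((_root_.map_ne_zero (algebraMap F K)).2 D.lam_ne_zero), h1]

/-- The norm is `τ² / λ`, which `φ` fixes because `φ τ = τ / λ` and `φ λ = λ⁻¹`. -/
lemma onQuadric_point (D : QuadricData q φ lam δ) (hτ0 : τ ≠ 0) (hτ : τ ^ q * lam = τ) :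
    OnQuadric φ (algebraMap F K τ * δ⁻¹) := by
  have ht0 : algebraMap F K τ ≠ 0 := (_root_.map_ne_zero (algebraMap F K)).2 hτ0
  have hl0 : algebraMap F K lam ≠ 0 := (_root_.map_ne_zero (algebraMap F K)).2 D.lam_ne_zero
  have hδ := D.ne_zero
  refine ⟨mul_ne_zero ht0 (inv_ne_zero hδ), ?_⟩
  have h1 : φ (algebraMap F K τ) * algebraMap F K lam = algebraMap F K τ := by
    rw [D.frob, ← map_pow, ← map_mul, hτ]
  have h2 : φ (algebraMap F K lam) * algebraMap F K lam = 1 := by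
    rw [D.frob, ← map_pow, ← map_mul, ← pow_succ, D.lam_pow, map_one]
  have hN : quadNorm φ (algebraMap F K τ * δ⁻¹) =
      algebraMap F K τ ^ 2 * (algebraMap F K lam)⁻¹ := by
    rw [quadNorm_apply, map_mul, map_mul, D.frob_frob_algebraMap, map_inv₀, map_inv₀,
      map_map_eq_pow D.frob, ← D.pow_eq, pow_succ δ, mul_inv]
    ring
  rw [hN, map_mul, map_pow, map_inv₀, eq_inv_of_mul_eq_one_left h2, inv_inv]
  rw [eq_mul_inv_iff_mul_eq₀ hl0]
  linear_combination (φ (algebraMap F K τ) * algebraMap F K lam + algebraMap F K τ) * h1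

lemma fixed_point_pow (D : QuadricData q φ lam δ) (hτ0 : τ ≠ 0) (hτ : τ ^ q * lam = τ) (d : ℕ)
    (h : φ ((algebraMap F K τ * δ⁻¹) ^ d) = (algebraMap F K τ * δ⁻¹) ^ d) : q ^ 2 + 1 ∣ d := by
  apply D.general
  have ht0 : algebraMap F K τ ≠ 0 := (_root_.map_ne_zero (algebraMap F K)).2 hτ0
  rw [map_pow, D.frob_point hτ, mul_pow, mul_pow, mul_right_inj' (pow_ne_zero _ ht0), inv_pow,
    inv_pow, inv_inj, ← pow_mul, add_mul, one_mul, pow_add] at h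
  exact mul_right_cancel₀ (pow_ne_zero d D.ne_zero) (h.trans (one_mul _).symm)

/-- The nonzero factors `τⁱ` leave the zeros unchanged, so zeros of a word become quadric points on
a plane. -/
lemma algebraMap_traceWord (D : QuadricData q φ lam δ) (hτ : τ ^ q * lam = τ) (a b : K)
    (i : Fin (q ^ 2 + 1)) :
    algebraMap F K (τ ^ (i : ℕ) * traceWord F (q ^ 2 + 1) δ (δ ^ (q ^ 2 + q + 1)) (a, b) i) =
      sectionForm φ a b ((algebraMap F K τ * δ⁻¹) ^ (i : ℕ)) := by
  rw [traceWord_apply, ← smul_eq_mul, ← map_smul, D.algebraMap_trace, sectionForm_apply, map_pow,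
    D.frob_point hτ, Algebra.smul_def, map_pow]
  congr 1
  ring

lemma card_wordZeros_traceWord [DecidableEq F] (D : QuadricData q φ lam δ) {a b : K}
    (hab : a ≠ 0 ∨ b ≠ 0) :
    (wordZeros (traceWord F (q ^ 2 + 1) δ (δ ^ (q ^ 2 + q + 1)) (a, b))).card ∈
      ({0, 1, 2, q + 1} : Set ℕ) := by
  obtain ⟨τ, hτ0, hτ⟩ := D.exists_scaling
  rw [← Set.ncard_coe_finset]
  convert ncard_sectionForm_pow_eq_zero D.one_lt D.card_ext D.frob (D.onQuadric_point hτ0 hτ)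
    (D.fixed_point_pow hτ0 hτ) hab using 2
  ext i
  rw [mem_coe, mem_wordZeros, Set.mem_ofPred_eq, ← D.algebraMap_traceWord hτ, map_eq_zero,
    mul_eq_zero, or_iff_right (pow_ne_zero _ hτ0)]

/-- A kernel element gives the zero word, whose `q² + 1` zeros are too many for a plane section. -/
lemma traceWord_injective (D : QuadricData q φ lam δ) :
    Function.Injective (traceWord F (q ^ 2 + 1) δ (δ ^ (q ^ 2 + q + 1))) := by
  classical
  rw [← LinearMap.ker_eq_bot, LinearMap.ker_eq_bot']
  rintro ⟨a, b⟩ h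
  by_contra hne
  have hab : a ≠ 0 ∨ b ≠ 0 := by
    by_contra! h0
    exact hne (by rw [h0.1, h0.2]; rfl)
  have hz := D.card_wordZeros_traceWord hab
  rw [h, wordZeros_zero, card_univ, Fintype.card_fin] at hz
  have := D.two_lt
  simp only [Set.mem_insert_iff, Set.mem_singleton_iff] at hz
  rcases hz with hz | hz | hz | hz <;> nlinarith

lemma lam_pow_q (D : QuadricData q φ lam δ) : lam ^ (q ^ 2 + q + 1) = lam := by
  rw [pow_succ, show q ^ 2 + q = (q + 1) * q by ring, pow_mul, D.lam_pow, one_pow, one_mul]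

lemma pow_eq' (D : QuadricData q φ lam δ) :
    (δ ^ (q ^ 2 + q + 1)) ^ (q ^ 2 + 1) = algebraMap F K lam := by
  rw [← pow_mul, mul_comm, pow_mul, D.pow_eq, ← map_pow, D.lam_pow_q]

lemma minpoly_ne (D : QuadricData q φ lam δ) :
    minpoly F δ ≠ minpoly F (δ ^ (q ^ 2 + q + 1)) := by
  intro h
  have hδ := D.ne_zero
  have hone : δ ^ (q ^ 2 + q) ≠ 1 := by
    intro h1
    have := D.general 1 (by rwa [mul_one])
    have := Nat.le_of_dvd one_pos this
    have := D.two_lt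
    nlinarith
  -- `P` has roots `δ` and `δ^(q²)`. If `δ^(q²+q+1)` were one of them, then `δ^(q²+q) = 1`.
  set P : F[X] := X ^ 2 - Polynomial.C (Algebra.trace F K δ) * X + Polynomial.C lam with hP
  have heval : ∀ x : K, aeval x P = (x - δ) * (x - δ ^ q ^ 2) := by
    intro x
    simp only [hP, map_add, map_sub, map_mul, map_pow, aeval_X, aeval_C, D.algebraMap_trace,
      quadTrace_apply, map_map_eq_pow D.frob, ← D.pow_eq]
    ring
  have hdvd : minpoly F (δ ^ (q ^ 2 + q + 1)) ∣ P :=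
    h ▸ minpoly.dvd F δ (by rw [heval, sub_self, zero_mul])
  have h0 := aeval_eq_zero_of_dvd_aeval_eq_zero hdvd (minpoly.aeval F _)
  rw [heval, mul_eq_zero, sub_eq_zero, sub_eq_zero] at h0
  rcases h0 with h0 | h0
  · rw [pow_succ] at h0
    exact hone (mul_right_cancel₀ hδ (h0.trans (one_mul δ).symm))
  · rw [add_assoc, pow_add] at h0
    have h1 : δ ^ (q + 1) = 1 :=
      mul_left_cancel₀ (pow_ne_zero _ hδ) (h0.trans (mul_one _).symm)
    apply hone
    rw [show q ^ 2 + q = (q + 1) * q by ring, pow_mul, h1, one_pow]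

lemma check_dvd (D : QuadricData q φ lam δ) :
    minpoly F δ * minpoly F (δ ^ (q ^ 2 + q + 1)) ∣ X ^ (q ^ 2 + 1) - Polynomial.C lam := by
  have hi : ∀ x : K, IsIntegral F x := fun x => Algebra.IsIntegral.isIntegral x
  refine IsCoprime.mul_dvd ?_ (minpoly_dvd_X_pow_sub_C D.pow_eq) (minpoly_dvd_X_pow_sub_C D.pow_eq')
  refine (minpoly.irreducible (hi _)).isCoprime_or_dvd _ |>.resolve_right fun hd => D.minpoly_ne ?_
  exact eq_of_monic_of_associated (minpoly.monic (hi _)) (minpoly.monic (hi _))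
    ((minpoly.irreducible (hi _)).associated_of_dvd (minpoly.irreducible (hi _)) hd)

lemma natDegree_check_le (D : QuadricData q φ lam δ) :
    (minpoly F δ * minpoly F (δ ^ (q ^ 2 + q + 1))).natDegree ≤ 4 := by
  have h : ∀ x : K, (minpoly F x).natDegree ≤ 2 := fun x =>
    (minpoly.natDegree_le x).trans D.finrank_eq_two.le
  have := h δ
  have := h (δ ^ (q ^ 2 + q + 1))
  exact natDegree_mul_le.trans (by omega)

lemma isRoot_frob (D : QuadricData q φ lam δ) {p : F[X]} {θ : K} (h : aeval θ p = 0) :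
    aeval (φ (φ θ)) p = 0 := by
  have hcomp : ((φ.comp φ).comp (algebraMap F K)) = algebraMap F K := by
    ext x; exact D.frob_frob_algebraMap x
  have := congrArg (φ.comp φ) h
  rw [map_zero, aeval_def, hom_eval₂, hcomp] at this
  exact this

/-- The trace splits the word into geometric words for `θ` and its conjugate `φ² θ`, both roots of
`p`. -/
lemma dvd_traceSum (D : QuadricData q φ lam δ) {p : F[X]} {θ : K}
    (hθ : θ ^ (q ^ 2 + 1) = algebraMap F K lam) (h : aeval θ p = 0) (a : K) :
    (X ^ (q ^ 2 + 1) - Polynomial.C lam).map (algebraMap F K) ∣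
      wordPoly (fun i : Fin (q ^ 2 + 1) => quadTrace φ (a * θ⁻¹ ^ (i : ℕ))) *
        p.map (algebraMap F K) := by
  have hθ0 : θ ≠ 0 := by
    rintro rfl
    rw [zero_pow (by omega), eq_comm, map_eq_zero] at hθ
    exact D.lam_ne_zero hθ
  have hθ' : φ (φ θ) ^ (q ^ 2 + 1) = algebraMap F K lam := by
    rw [← map_pow, ← map_pow, hθ, D.frob_frob_algebraMap]
  have hsplit : wordPoly (fun i : Fin (q ^ 2 + 1) => quadTrace φ (a * θ⁻¹ ^ (i : ℕ))) =
      wordPoly (fun i : Fin (q ^ 2 + 1) => a * θ⁻¹ ^ (i : ℕ)) +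
        wordPoly (fun i : Fin (q ^ 2 + 1) => φ (φ a) * (φ (φ θ))⁻¹ ^ (i : ℕ)) := by
    simp only [wordPoly, ← sum_add_distrib, ← add_mul, ← map_add]
    simp only [quadTrace_apply, map_mul, map_pow, map_inv₀]
  rw [hsplit, add_mul, Polynomial.map_sub, Polynomial.map_pow, map_X, map_C]
  refine dvd_add (dvd_geom_word_mul hθ hθ0 ?_ a) (dvd_geom_word_mul hθ' ?_ ?_ _)
  · rwa [IsRoot, eval_map_algebraMap]
  · exact (map_ne_zero φ).2 ((map_ne_zero φ).2 hθ0)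
  · rw [IsRoot, eval_map_algebraMap]
    exact D.isRoot_frob h

lemma range_traceWord_le (D : QuadricData q φ lam δ) :
    (traceWord F (q ^ 2 + 1) δ (δ ^ (q ^ 2 + q + 1))).range ≤
      codeOfCheck (q ^ 2 + 1) lam (minpoly F δ * minpoly F (δ ^ (q ^ 2 + q + 1))) := by
  rintro _ ⟨⟨a, b⟩, rfl⟩
  rw [mem_codeOfCheck_iff (by omega) D.check_dvd, ← map_dvd_map' (algebraMap F K),
    Polynomial.map_mul]
  have hsplit : (wordPoly (traceWord F (q ^ 2 + 1) δ (δ ^ (q ^ 2 + q + 1)) (a, b))).map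
      (algebraMap F K) =
      wordPoly (fun i : Fin (q ^ 2 + 1) => quadTrace φ (a * δ⁻¹ ^ (i : ℕ))) +
      wordPoly (fun i : Fin (q ^ 2 + 1) =>
        quadTrace φ (b * (δ ^ (q ^ 2 + q + 1))⁻¹ ^ (i : ℕ))) := by
    simp only [wordPoly, Polynomial.map_sum, Polynomial.map_mul, Polynomial.map_pow, map_X, map_C,
      ← sum_add_distrib, ← add_mul, ← map_add, traceWord_apply, D.algebraMap_trace]
  rw [hsplit, add_mul]
  exact dvd_add (D.dvd_traceSum D.pow_eq (by rw [map_mul, minpoly.aeval, zero_mul]) a)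
    (D.dvd_traceSum D.pow_eq' (by rw [map_mul, minpoly.aeval, mul_zero]) b)

lemma finrank_range_traceWord (D : QuadricData q φ lam δ) :
    Module.finrank F (traceWord F (q ^ 2 + 1) δ (δ ^ (q ^ 2 + q + 1))).range = 4 := by
  rw [LinearMap.finrank_range_of_inj D.traceWord_injective, Module.finrank_prod, D.finrank_eq_two]

/-- The trace description of the constacyclic code. -/
theorem codeOfCheck_eq_range (D : QuadricData q φ lam δ) :
    codeOfCheck (q ^ 2 + 1) lam (minpoly F δ * minpoly F (δ ^ (q ^ 2 + q + 1))) =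
      (traceWord F (q ^ 2 + 1) δ (δ ^ (q ^ 2 + q + 1))).range := by
  refine (Submodule.eq_of_le_of_finrank_le D.range_traceWord_le ?_).symm
  rw [D.finrank_range_traceWord]
  exact (finrank_codeOfCheck_le (by omega) D.check_dvd).trans D.natDegree_check_le

/-- Nondegeneracy of the trace form turns orthogonality to all trace words into two relations over
`K`. -/
lemma sum_eq_zero_of_mem_dualCode (D : QuadricData q φ lam δ) {x : Fin (q ^ 2 + 1) → F}
    (hx : x ∈ dualCode (traceWord F (q ^ 2 + 1) δ (δ ^ (q ^ 2 + q + 1))).range) :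
    ∑ i, algebraMap F K (x i) * δ⁻¹ ^ (i : ℕ) = 0 ∧
      ∑ i, algebraMap F K (x i) * (δ ^ (q ^ 2 + q + 1))⁻¹ ^ (i : ℕ) = 0 := by
  constructor <;> refine D.eq_zero_of_trace_mul (F := F) fun a => ?_
  · rw [← hx _ ⟨(a, 0), rfl⟩, mul_sum, map_sum]
    refine sum_congr rfl fun i _ => ?_
    rw [traceWord_apply, zero_mul, add_zero, mul_comm (Algebra.trace F K _), ← smul_eq_mul (x i),
      ← map_smul, Algebra.smul_def, mul_left_comm]
  · rw [← hx _ ⟨(0, a), rfl⟩, mul_sum, map_sum]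
    refine sum_congr rfl fun i _ => ?_
    rw [traceWord_apply, zero_mul, zero_add, mul_comm (Algebra.trace F K _), ← smul_eq_mul (x i),
      ← map_smul, Algebra.smul_def, mul_left_comm]

theorem isOvoidCode [DecidableEq F] (D : QuadricData q φ lam δ) :
    IsOvoidCode (codeOfCheck (q ^ 2 + 1) lam
      (minpoly F δ * minpoly F (δ ^ (q ^ 2 + q + 1)))) := by
  rw [D.codeOfCheck_eq_range]
  refine ⟨D.two_lt, D.card_field, D.finrank_range_traceWord, ?_, ?_⟩
  · intro x hx hw
    obtain ⟨h1, h2⟩ := D.sum_eq_zero_of_mem_dualCode hx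
    obtain ⟨τ, hτ0, hτ⟩ := D.exists_scaling
    have ht0 : algebraMap F K τ ≠ 0 := (_root_.map_ne_zero (algebraMap F K)).2 hτ0
    -- Dividing `x i` by `τⁱ` turns these into relations among the points `ζⁱ` and `φ(ζⁱ)`.
    have hy := eq_zero_of_sum_pow D.two_lt (map_four D.card_ext D.frob) (D.onQuadric_point hτ0 hτ)
      (D.fixed_point_pow hτ0 hτ) (S := wordSupport x) hw
      (y := fun i => algebraMap F K (x i * (τ ^ (i : ℕ))⁻¹))
      (fun i => D.frob_frob_algebraMap _) ?_ ?_ ?_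
    · ext i
      have := congrFun hy i
      rw [Pi.zero_apply, map_eq_zero, mul_eq_zero, or_iff_left (inv_ne_zero (pow_ne_zero _ hτ0))]
        at this
      exact this
    · intro i hi
      have : x i = 0 := by simpa [wordSupport] using hi
      rw [this, zero_mul, map_zero]
    · rw [← h1]
      refine sum_congr rfl fun i _ => ?_
      rw [map_mul, map_inv₀, map_pow, mul_pow, mul_assoc,
        inv_mul_cancel_left₀ (pow_ne_zero _ ht0)]
    · rw [← h2]
      refine sum_congr rfl fun i _ => ?_
      rw [map_pow, D.frob_point hτ, map_mul, map_inv₀, map_pow, mul_pow, mul_assoc,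
        inv_mul_cancel_left₀ (pow_ne_zero _ ht0)]
  · rintro _ ⟨⟨a, b⟩, rfl⟩ h0
    have hab : a ≠ 0 ∨ b ≠ 0 := by
      by_contra! h
      exact h0 (by rw [h.1, h.2]; exact map_zero _)
    simpa using D.card_wordZeros_traceWord hab

end QuadricData

end TraceCode

end ConstacyclicDesign

/-! ### Choice of the primitive element and the 2-adic condition. -/

namespace ConstacyclicDesign

/-- Every element of order `r` is the corresponding power of some generator. -/
lemma exists_isPrimitiveRoot_pow_eq {K : Type*} [Field K] [Finite K] {x : K} {r s : ℕ}
    (hx : IsPrimitiveRoot x r) (hrs : Nat.card K - 1 = s * r) :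
    ∃ β : K, IsPrimitiveRoot β (Nat.card K - 1) ∧ β ^ s = x := by
  have hpos : 0 < Nat.card K - 1 := Nat.sub_pos_of_lt Finite.one_lt_card
  obtain ⟨g, hprim⟩ := exists_isPrimitiveRoot_card_sub_one K
  have hr : 0 < r := Nat.pos_of_mul_pos_left (hrs ▸ hpos)
  have hω := hprim.pow hpos hrs
  have : NeZero r := ⟨hr.ne'⟩
  have : NeZero (Nat.card K - 1) := ⟨hpos.ne'⟩
  obtain ⟨i, -, hi⟩ := hω.eq_pow_of_pow_eq_one hx.pow_eq_one
  have hcop : i.Coprime r := (hω.pow_iff_coprime hr i).1 (hi ▸ hx)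
  have hdvd : r ∣ Nat.card K - 1 := hrs ▸ dvd_mul_left r s
  -- Units modulo `r` lift to units modulo `|K| - 1`, so the exponent can be chosen to give a
  -- generator.
  obtain ⟨u, hu⟩ := ZMod.unitsMap_surjective hdvd (ZMod.unitOfCoprime i hcop)
  set j := (u : ZMod (Nat.card K - 1)).val with hj
  have hjc : j.Coprime (Nat.card K - 1) := ZMod.val_coe_unit_coprime u
  refine ⟨g ^ j, hprim.pow_of_coprime j hjc, ?_⟩
  have hmod : j ≡ i [MOD r] := by
    rw [← ZMod.natCast_eq_natCast_iff]
    have h := congrArg Units.val hu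
    rw [ZMod.unitsMap_val, ZMod.coe_unitOfCoprime, ← ZMod.natCast_val] at h
    exact h
  rw [← pow_mul, mul_comm, pow_mul, ← hi]
  rw [pow_eq_pow_mod j hω.pow_eq_one, pow_eq_pow_mod i hω.pow_eq_one, hmod]

/-- The arithmetic behind the condition on the 2-adic valuation of `r`. -/
lemma dvd_of_mul_dvd {q r d : ℕ} (hr : r ∣ q + 1)
    (hν : padicValNat 2 r = padicValNat 2 (q + 1))
    (h : r * (q ^ 2 + 1) ∣ (q ^ 2 + q) * d) : q ^ 2 + 1 ∣ d := by
  obtain ⟨s, hs⟩ := hr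
  have hr0 : r ≠ 0 := by rintro rfl; simp at hs
  have hs0 : s ≠ 0 := by rintro rfl; simp at hs
  -- Equal valuations make `s = (q + 1) / r` odd, and `gcd(q² + 1, q + 1)` divides two; hence `s` is
  -- coprime to `q² + 1`.
  have hs2 : ¬ 2 ∣ s := by
    intro h2
    rw [hs, padicValNat.mul hr0 hs0] at hν
    have := one_le_padicValNat_of_dvd hs0 h2
    omega
  have h1 : q ^ 2 + 1 ∣ s * q * d := by
    apply Nat.dvd_of_mul_dvd_mul_left (Nat.pos_of_ne_zero hr0)
    convert h using 1
    rw [show q ^ 2 + q = q * (q + 1) by ring, hs]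
    ring
  have hcq : (q ^ 2 + 1).Coprime q := by
    rw [sq]; simp
  have hcs : (q ^ 2 + 1).Coprime s := by
    have hg1 := Nat.gcd_dvd_left (q ^ 2 + 1) s
    have hg2 := Nat.gcd_dvd_right (q ^ 2 + 1) s
    have hg3 : (q ^ 2 + 1).gcd s ∣ q + 1 := hg2.trans (hs ▸ dvd_mul_left s r)
    have hg4 : (q ^ 2 + 1).gcd s ∣ 2 := by
      have e : (q + 1) * (q + 1) + 2 = (q ^ 2 + 1) + 2 * (q + 1) := by ring
      exact (Nat.dvd_add_right (hg3.mul_right (q + 1))).1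
        (e ▸ dvd_add hg1 (hg3.mul_left 2))
    rcases (Nat.dvd_prime Nat.prime_two).1 hg4 with h | h
    · exact h
    · exact absurd (h ▸ hg2) hs2
  exact (hcs.mul_right hcq).dvd_of_dvd_mul_left h1

end ConstacyclicDesign



open ConstacyclicDesign in
theorem theorem1 (p m q r : ℕ) (hp : p.Prime) (hm : 0 < m) (hq : q = p ^ m) (hq2 : 2 < q)
    {F K : Type*} [Field F] [Fintype F] [DecidableEq F] [Field K] [Fintype K] [Algebra F K]
    (hF : Fintype.card F = q ^ 2) (hK : Fintype.card K = q ^ 4)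
    (lam : Fˣ) (hr : orderOf lam = r) (hrq : r ∣ q + 1)
    (hν : padicValNat 2 r = padicValNat 2 (q + 1)) :
    -- a primitive element of `K` as used below exists
    (∃ β : K, IsPrimitiveRoot β (q ^ 4 - 1) ∧
      (β ^ ((q ^ 2 - 1) / r)) ^ (q ^ 2 + 1) = algebraMap F K lam) ∧
    ∀ β δ : K, IsPrimitiveRoot β (q ^ 4 - 1) → δ = β ^ ((q ^ 2 - 1) / r) →
      δ ^ (q ^ 2 + 1) = algebraMap F K lam →
      ∀ h : F[X], h = minpoly F δ * minpoly F (δ ^ (q ^ 2 + q + 1)) →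
      ∀ 𝒞 : Submodule F (Fin (q ^ 2 + 1) → F), 𝒞 = codeOfCheck (q ^ 2 + 1) (lam : F) h →
        h ∣ X ^ (q ^ 2 + 1) - C (lam : F) ∧
        IsConstacyclic (lam : F) 𝒞 ∧
        HasParameters 𝒞 4 (q ^ 2 - q) ∧
        weightEnumerator 𝒞 =
          1 + C ((q : ℚ) ^ 5 - q) * X ^ (q ^ 2 - q)
            + C (((q : ℚ) ^ 4 - 1) * (q - 1) * q ^ 3 / 2) * (X ^ (q ^ 2 - 1) + X ^ (q ^ 2 + 1))
            + C ((q : ℚ) ^ 7 - q ^ 5 + q ^ 4 - q ^ 3 + q - 1) * X ^ (q ^ 2) ∧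
        SupportsDesign 𝒞 3 (q ^ 2 + 1) (q ^ 2 - q) ((q ^ 2 - q - 1) * (q - 2)) ∧
        HasParameters (dualCode 𝒞) (q ^ 2 - 3) 4 ∧
        SupportsDesign (dualCode 𝒞) 3 (q ^ 2 + 1) 4 (q - 2) := by

  have hrpos : 0 < r := Nat.pos_of_dvd_of_pos hrq (by omega)
  have hKc : Nat.card K = q ^ 4 := by rw [Nat.card_eq_fintype_card, hK]
  have hrq' : r ∣ q ^ 2 - 1 := by
    have : q ^ 2 - 1 = (q + 1) * (q - 1) := by rw [← Nat.sq_sub_sq q 1, one_pow]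
    rw [this]
    exact hrq.mul_right _
  have hfac : q ^ 4 - 1 = (q ^ 2 - 1) / r * (q ^ 2 + 1) * r := by
    have h1 : q ^ 4 - 1 = (q ^ 2 + 1) * (q ^ 2 - 1) := by
      rw [show q ^ 4 = (q ^ 2) ^ 2 by ring, ← Nat.sq_sub_sq (q ^ 2) 1, one_pow]
    rw [h1, mul_right_comm, Nat.div_mul_cancel hrq', mul_comm]
  have hlam : IsPrimitiveRoot (algebraMap F K lam) r := by
    rw [← hr]
    exact ((IsPrimitiveRoot.orderOf lam).map_of_injective
      (f := Units.coeHom F) Units.val_injective).map_of_injective (algebraMap F K).injective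
  refine ⟨?_, ?_⟩
  · obtain ⟨β, hβ, hβlam⟩ := exists_isPrimitiveRoot_pow_eq hlam (hKc.symm ▸ hfac)
    exact ⟨β, hKc ▸ hβ, by rw [← pow_mul, hβlam]⟩
  · rintro β δ hβ hδ hδn h rfl 𝒞 rfl
    have hpos : 0 < q ^ 4 - 1 := by
      have := Nat.one_lt_pow (n := 4) (by norm_num) (show 1 < q by omega)
      omega
    have hδprim : IsPrimitiveRoot δ (r * (q ^ 2 + 1)) :=
      hδ ▸ hβ.pow hpos (hfac.trans (by ring))
    have : Fact p.Prime := ⟨hp⟩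
    -- The order of `K` is a power of `p`; the characteristic is needed for the iterated Frobenius
    -- to be a ring map.
    have hchar : CharP K p := by
      obtain ⟨p', hp'⟩ := CharP.exists K
      obtain ⟨k, hp'prime, hcard⟩ := FiniteField.card K p'
      have hdvd : p ∣ p' ^ (k : ℕ) := by
        rw [← hcard, hK, hq]
        exact (dvd_pow_self p hm.ne').trans (dvd_pow_self _ (by norm_num))
      rwa [(Nat.prime_dvd_prime_iff_eq hp hp'prime).1 (hp.dvd_of_dvd_pow hdvd)]
    have D : QuadricData q (iterateFrobenius K p m) (lam : F) δ :=
      { two_lt := hq2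
        card_field := hF
        card_ext := hKc
        frob := fun x => by rw [iterateFrobenius_def, hq]
        lam_pow := by
          have := orderOf_dvd_iff_pow_eq_one.1 (hr ▸ hrq : orderOf lam ∣ q + 1)
          simpa using congrArg Units.val this
        pow_eq := hδn
        general := fun d hd => dvd_of_mul_dvd hrq hν (hδprim.dvd_of_pow_eq_one _ hd) }
    have hC := D.isOvoidCode
    exact ⟨D.check_dvd, isConstacyclic_codeOfCheck _ _, hC.hasParameters, hC.weightEnumerator_eq,
      hC.supportsDesign, hC.hasParameters_dualCode, hC.supportsDesign_dualCode⟩
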